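/- Consider graphs on the vertex set $\{0,\dots,n-1\}$, $n\ge 1$, in the adjacency array model: the (out-)degrees $d_0,\dots,d_{n-1}$ are known in advance at no cost, and for every vertex $i$ an injective array $f_i:\{0,\dots,d_i-1\}\to\{0,\dots,n-1\}$, listing the (out-)neighbours of $i$ in arbitrary order, is accessible only through quantum queries $|i,j\rangle|a\rangle\mapsto|i,j\rangle|a+f_i(j) \bmod n\rangle$. For undirected graphs it is promised in addition that $v$ occurs in the array of $u$ if and only if $u$ occurs in the array of $v$. The bounded-error quantum query complexity of a problem is the least number of queries $T$ of a quantum algorithm that makes at most $T$ queries and answers correctly with probability at least $2/3$ on every admissible input; its value at $n$ is the maximum over all degree sequences $(d_0,\dots,d_{n-1})$. Then: (a) The problem Strong Connectivity (decide whether a given directed graph on $n$ vertices has a directed path from every vertex to every other vertex) has bounded-error quantum query complexity $\Omega(n)$ in the array model. (b) The problem Connectivity (decide whether a given undirected graph on $n$ vertices is connected) has bounded-error quantum query complexity $\Omega(n)$ and $O(n)$, hence $\Theta(n)$, in the array model. The same holds for the version of Connectivity in which the algorithm has to output a spanning tree if the graph is connected, and to report that it is not connected otherwise. -/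

import Mathlib

/-! ### The quantum query model

An input is a function `x : I → A`, accessible only through the oracle
`O_x |i, a, w⟩ = |i, a + x i, w⟩`.  Here `A` is a finite additive group (for arrays of vertices it is
`Fin n` with addition modulo `n`).  The index register has one additional value `none`, on which the
oracle acts as the identity, so that queries may be controlled and indices may be absent. -/

/-- A quantum algorithm making `T` queries to an input `x : I → A`: a finite work register, an
initial basis state, input-independent unitaries `U 0, …, U T` (later ones are never applied),
with one query between consecutive ones, and a final measurement in the computational basis whose
outcome `b` is turned into the answer `output b`. -/
structure QueryAlgorithm (I A Out : Type) [Fintype I] [DecidableEq I] [Fintype A] [DecidableEq A]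
    (T : ℕ) where
  Work : Type
  [fintypeWork : Fintype Work]
  [decidableEqWork : DecidableEq Work]
  start : Option I × A × Work
  U : ℕ → Matrix.unitaryGroup (Option I × A × Work) ℂ
  output : Option I × A × Work → Out

attribute [instance] QueryAlgorithm.fintypeWork QueryAlgorithm.decidableEqWork

/-- The oracle `O_x`, acting on amplitude vectors: the amplitude of `|i, a, w⟩` after the query is the
amplitude of `|i, a - x i, w⟩` before it. -/
def queryOracle {I A W : Type} [AddGroup A] (x : I → A) (ψ : Option I × A × W → ℂ) :
    Option I × A × W → ℂ
  | (none, a, w) => ψ (none, a, w)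
  | (some i, a, w) => ψ (some i, a - x i, w)

namespace QueryAlgorithm

variable {I A Out : Type} [Fintype I] [DecidableEq I] [Fintype A] [DecidableEq A] [AddGroup A]
  {T : ℕ}

/-- The state `U t · O_x · U (t-1) · ⋯ · O_x · U 0 |start⟩`, after `t` queries. -/
noncomputable def state (alg : QueryAlgorithm I A Out T) (x : I → A) :
    ℕ → Option I × A × alg.Work → ℂ
  | 0 => Matrix.mulVec (alg.U 0 : Matrix _ _ ℂ) (Pi.single alg.start 1)
  | t + 1 => Matrix.mulVec (alg.U (t + 1) : Matrix _ _ ℂ) (queryOracle x (alg.state x t))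

open Classical in
/-- The probability that the answer on input `x`, after all `T` queries, lies in `S`. -/
noncomputable def prob (alg : QueryAlgorithm I A Out T) (x : I → A) (S : Set Out) : ℝ :=
  ∑ b : Option I × A × alg.Work, if alg.output b ∈ S then ‖alg.state x T b‖ ^ 2 else 0

/-- Bounded error: on every promised input the answer is an acceptable one with probability at
least `2/3`. -/
def Solves (alg : QueryAlgorithm I A Out T) (promise : Set (I → A))
    (accepted : (I → A) → Set Out) : Prop :=
  ∀ x ∈ promise, 2 / 3 ≤ alg.prob x (accepted x)

end QueryAlgorithm

/-- Bounded-error quantum query complexity of a (promise, possibly multi-valued) problem: the least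
number of queries of an algorithm that solves it (`⊤` if there is none). -/
noncomputable def quantumQueryComplexity {I A Out : Type} [Fintype I] [DecidableEq I] [Fintype A]
    [DecidableEq A] [AddGroup A] (promise : Set (I → A)) (accepted : (I → A) → Set Out) : ℕ∞ :=
  ⨅ (T : ℕ) (_ : ∃ alg : QueryAlgorithm I A Out T, alg.Solves promise accepted), (T : ℕ∞)

/-! ### The adjacency array model -/

/-- The positions of the arrays of an `n`-vertex graph with out-degrees `d`. -/
abbrev ArrayIndex (n : ℕ) (d : Fin n → ℕ) : Type := (i : Fin n) × Fin (d i)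

/-- The neighbour arrays: `f ⟨i, j⟩` is the `j`-th (out-)neighbour of vertex `i`. -/
abbrev Arrays (n : ℕ) (d : Fin n → ℕ) : Type := ArrayIndex n d → Fin n

namespace Arrays

variable {n : ℕ} {d : Fin n → ℕ}

/-- `(u, v)` is an edge of the directed graph given by the arrays. -/
def Edge (f : Arrays n d) (u v : Fin n) : Prop := ∃ j : Fin (d u), f ⟨u, j⟩ = v

/-- Promise for directed graphs: no multiple edges. -/
def NoMultipleEdges (f : Arrays n d) : Prop :=
  ∀ (i : Fin n) (j j' : Fin (d i)), j ≠ j' → f ⟨i, j⟩ ≠ f ⟨i, j'⟩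

/-- Additional promise for undirected graphs. -/
def Symmetric (f : Arrays n d) : Prop := ∀ u v : Fin n, f.Edge u v → f.Edge v u

/-- There is a directed path from any vertex to any other. -/
def StronglyConnected (f : Arrays n d) : Prop := ∀ u v : Fin n, Relation.ReflTransGen f.Edge u v

/-- The undirected graph given by symmetric arrays (loops play no role for connectivity). -/
def graph (f : Arrays n d) : SimpleGraph (Fin n) := SimpleGraph.fromRel f.Edge

/-- The admissible inputs with out-degrees `d`, for directed graphs. -/
def directedInputs (n : ℕ) (d : Fin n → ℕ) : Set (Arrays n d) := {f | f.NoMultipleEdges}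

/-- The admissible inputs with degrees `d`, for undirected graphs. -/
def undirectedInputs (n : ℕ) (d : Fin n → ℕ) : Set (Arrays n d) :=
  {f | f.NoMultipleEdges ∧ f.Symmetric}

end Arrays

/-! ### The problems

The degrees are known to the algorithm free of charge, so each degree sequence has its own query
problem, and the complexity on `n` vertices is the worst case over all degree sequences. -/

/-- Deciding whether a directed graph on `n` vertices is strongly connected. -/
noncomputable def strongConnectivityComplexity (n : ℕ) [NeZero n] : ℕ∞ :=
  ⨆ d : Fin n → ℕ, quantumQueryComplexity (Arrays.directedInputs n d)
    (fun f => {b : Bool | b = true ↔ Arrays.StronglyConnected f})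

/-- Deciding whether an undirected graph on `n` vertices is connected. -/
noncomputable def connectivityComplexity (n : ℕ) [NeZero n] : ℕ∞ :=
  ⨆ d : Fin n → ℕ, quantumQueryComplexity (Arrays.undirectedInputs n d)
    (fun f => {b : Bool | b = true ↔ (Arrays.graph f).Connected})

/-- Outputs acceptable for a graph `G`: a spanning tree of `G` if `G` is connected, and the answer
`none` if it is not. -/
def SpanningTreeAnswer {V : Type} (G : SimpleGraph V) : Option (SimpleGraph V) → Prop
  | none => ¬ G.Connected
  | some S => S ≤ G ∧ S.IsTree

/-- Connectivity with a witness: outputting a spanning tree of an undirected graph on `n` vertices,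
or reporting that the graph is not connected. -/
noncomputable def spanningTreeComplexity (n : ℕ) [NeZero n] : ℕ∞ :=
  ⨆ d : Fin n → ℕ, quantumQueryComplexity (Arrays.undirectedInputs n d)
    (fun f => {o | SpanningTreeAnswer (Arrays.graph f) o})

/-! ### Unitaries from Gram matrices -/

/-! Upper bound. A catalyst assigns to every input `x` a vector `v x` such that the pairs `start +
O_x (v x)` and `answer + v x` have the same Gram matrix. Families with equal Gram matrices differ by
a unitary, so one input-independent unitary following one query turns `start` into the answer and
gives the catalyst back (`exists_unitary_catalystStep`). Spreading the start over `T` copies, served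
one after another by the same catalyst of amplitude `1 / √T`, makes its absence at the beginning an
error of norm `‖v x‖ / √T`; hence `O(‖v x‖²)` queries suffice (`exists_queryAlgorithm_of_catalyst`).
A decision tree has a catalyst with squared norm equal to its weighted cost
(`DecisionTree.exists_catalyst`): a search through `m` positions for one unexpected answer costs
`O(√(m + 1))`, as in Grover search.

The tree for connectivity has two phases. The first reads rows classically, in order of decreasing
degree, and stops a row as soon as it meets a part built earlier. It costs `O(n)` and leaves
connected parts `C` all of whose vertices have degree at most `|C|`. The second repeatedly searches
the part of least total degree `m` for an outgoing edge, at cost `O(√m)`. The merge lowers the sum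
of the square roots of the total degrees by at least `√m / 2`, and this sum is at most `∑ |C| = n`
at the start, so the costs telescope to `O(n)`.

Lower bound. Parity of `p` bits is encoded in a ladder in which bit `q` decides whether the two
strands cross between rungs `q` and `q + 1`. All degrees are two, every array entry depends on at
most one bit, and the graph is connected exactly for even parity. Acceptance probabilities after `T`
queries have degree at most `2 T` in the bits, and parity is orthogonal to everything of degree
below `p` (`le_two_mul_of_solves_parity`). Symmetric arrays are strongly connected exactly when the
graph is connected, so the same inputs serve for directed graphs. -/

theorem exists_linearIsometry_of_inner_eq {ι E : Type*} [NormedAddCommGroup E]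
    [InnerProductSpace ℂ E] [FiniteDimensional ℂ E] (a b : ι → E)
    (h : ∀ i j, inner ℂ (a i) (a j) = inner ℂ (b i) (b j)) :
    ∃ L : E →ₗᵢ[ℂ] E, ∀ i, L (a i) = b i := by
  set f := Finsupp.linearCombination ℂ a with hf
  set g := Finsupp.linearCombination ℂ b with hg
  have hn : ∀ c, ‖f c‖ = ‖g c‖ := by
    intro c
    have : inner ℂ (f c) (f c) = inner ℂ (g c) (g c) := by
      simp only [hf, hg, Finsupp.linearCombination_apply, Finsupp.sum, sum_inner, inner_sum,
        inner_smul_left, inner_smul_right, h]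
    rw [inner_self_eq_norm_sq_to_K, inner_self_eq_norm_sq_to_K] at this
    have h2 : ‖f c‖ ^ 2 = ‖g c‖ ^ 2 := by exact_mod_cast this
    exact (sq_eq_sq₀ (norm_nonneg _) (norm_nonneg _)).1 h2
  -- Equality of norms gives `f` and `g` the same kernel, so `g ∘ s` carries `f c` to `g c` whatever
  -- section `s` is chosen.
  obtain ⟨s, hs⟩ := f.rangeRestrict.exists_rightInverse_of_surjective f.range_rangeRestrict
  have hs' : ∀ y : LinearMap.range f, f (s y) = y := fun y => by
    simpa using congrArg Subtype.val (LinearMap.congr_fun hs y)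
  let L₀ : LinearMap.range f →ₗᵢ[ℂ] E :=
    { toLinearMap := g ∘ₗ s
      norm_map' := fun y => by
        rw [LinearMap.comp_apply, ← hn, hs']; rfl }
  refine ⟨L₀.extend, fun i => ?_⟩
  have hfi : f (Finsupp.single i 1) = a i := by simp [hf]
  have hgi : g (Finsupp.single i 1) = b i := by simp [hg]
  have h1 := L₀.extend_apply ⟨a i, ⟨_, hfi⟩⟩
  refine h1.trans ?_
  change g (s ⟨a i, ⟨_, hfi⟩⟩) = b i
  rw [← hgi, ← sub_eq_zero, ← map_sub, ← norm_eq_zero, ← hn, map_sub, hs', hfi, sub_self, norm_zero]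

theorem toLp_inner_eq_dotProduct {X : Type*} [Fintype X] (ψ φ : X → ℂ) :
    inner ℂ (WithLp.toLp 2 ψ) (WithLp.toLp 2 φ) = star ψ ⬝ᵥ φ := by
  rw [EuclideanSpace.inner_eq_star_dotProduct, dotProduct_comm]

theorem exists_unitary_of_gram_eq {ι X : Type*} [Fintype X] [DecidableEq X] (a b : ι → X → ℂ)
    (h : ∀ i j, star (a i) ⬝ᵥ a j = star (b i) ⬝ᵥ b j) :
    ∃ U : Matrix.unitaryGroup X ℂ, ∀ i, (U : Matrix X X ℂ).mulVec (a i) = b i := by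
  obtain ⟨L, hL⟩ := exists_linearIsometry_of_inner_eq (fun i => WithLp.toLp 2 (a i))
    (fun i => WithLp.toLp 2 (b i)) fun i j => by simp only [toLp_inner_eq_dotProduct, h]
  let M : Matrix X X ℂ := LinearMap.toMatrix'
    ((WithLp.linearEquiv 2 ℂ (X → ℂ)).toLinearMap ∘ₗ L.toLinearMap ∘ₗ
      (WithLp.linearEquiv 2 ℂ (X → ℂ)).symm.toLinearMap)
  have hM : ∀ v, M.mulVec v = WithLp.ofLp (L (WithLp.toLp 2 v)) := fun v => by
    rw [← Matrix.toLin'_apply, Matrix.toLin'_toMatrix']; rfl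
  have hU : M ∈ Matrix.unitaryGroup X ℂ := by
    rw [Matrix.mem_unitaryGroup_iff']
    ext i j
    have h1 : (star M * M) i j =
        star (M.mulVec (Pi.single i 1)) ⬝ᵥ M.mulVec (Pi.single j 1) := by
      simp [Matrix.mul_apply, dotProduct]
    rw [h1, hM, hM, ← toLp_inner_eq_dotProduct]
    change inner ℂ (L _) (L _) = _
    rw [L.inner_map_map, toLp_inner_eq_dotProduct]
    simp [Matrix.one_apply, Pi.single_apply, eq_comm]
  refine ⟨⟨M, hU⟩, fun i => ?_⟩
  change M.mulVec _ = _
  rw [hM, hL]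

theorem unitary_dotProduct {X : Type*} [Fintype X] [DecidableEq X] (U : Matrix.unitaryGroup X ℂ)
    (ψ φ : X → ℂ) :
    star ((U : Matrix X X ℂ).mulVec ψ) ⬝ᵥ (U : Matrix X X ℂ).mulVec φ = star ψ ⬝ᵥ φ := by
  rw [Matrix.star_mulVec, ← Matrix.dotProduct_mulVec, Matrix.mulVec_mulVec,
    ← Matrix.star_eq_conjTranspose, Matrix.UnitaryGroup.star_mul_self, Matrix.one_mulVec]

/-! ### The oracle -/

/-- The permutation of basis states by which the oracle acts. -/
def queryEquiv {I A W : Type} [AddGroup A] (x : I → A) :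
    Option I × A × W ≃ Option I × A × W where
  toFun | (none, a, w) => (none, a, w)
        | (some i, a, w) => (some i, a - x i, w)
  invFun | (none, a, w) => (none, a, w)
         | (some i, a, w) => (some i, a + x i, w)
  left_inv := by rintro ⟨_ | i, a, w⟩ <;> simp
  right_inv := by rintro ⟨_ | i, a, w⟩ <;> simp

theorem queryOracle_eq_comp {I A W : Type} [AddGroup A] (x : I → A)
    (ψ : Option I × A × W → ℂ) : queryOracle x ψ = ψ ∘ queryEquiv x := by
  funext ⟨i, a, w⟩
  cases i <;> rfl

theorem queryOracle_add {I A W : Type} [AddGroup A] (x : I → A)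
    (ψ φ : Option I × A × W → ℂ) :
    queryOracle x (ψ + φ) = queryOracle x ψ + queryOracle x φ := by
  simp only [queryOracle_eq_comp]; rfl

theorem queryOracle_smul {I A W : Type} [AddGroup A] (x : I → A) (c : ℂ)
    (ψ : Option I × A × W → ℂ) :
    queryOracle x (c • ψ) = c • queryOracle x ψ := by
  simp only [queryOracle_eq_comp]; rfl

theorem queryOracle_dotProduct {I A W : Type} [AddGroup A] [Fintype I] [Fintype A] [Fintype W]
    (x : I → A) (ψ φ : Option I × A × W → ℂ) :
    star (queryOracle x ψ) ⬝ᵥ queryOracle x φ = star ψ ⬝ᵥ φ := by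
  simp only [queryOracle_eq_comp, dotProduct]
  exact (queryEquiv x).sum_comp fun b => star (ψ b) * φ b

/-! ### Squared norms -/

/-- The squared `ℓ²` norm of a vector of amplitudes. -/
noncomputable def sqNorm {X : Type*} [Fintype X] (ψ : X → ℂ) : ℝ := ∑ b, ‖ψ b‖ ^ 2

theorem dotProduct_star_self {X : Type*} [Fintype X] (ψ : X → ℂ) :
    star ψ ⬝ᵥ ψ = (sqNorm ψ : ℂ) := by
  simp [sqNorm, dotProduct, RCLike.conj_mul]

theorem sqNorm_eq_of_dotProduct_eq {X Y : Type*} [Fintype X] [Fintype Y] {ψ : X → ℂ} {φ : Y → ℂ}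
    (h : star ψ ⬝ᵥ ψ = star φ ⬝ᵥ φ) : sqNorm ψ = sqNorm φ := by
  rw [dotProduct_star_self, dotProduct_star_self] at h
  exact_mod_cast h

theorem sqNorm_eq_norm_sq {X : Type*} [Fintype X] (ψ : X → ℂ) :
    sqNorm ψ = ‖WithLp.toLp 2 ψ‖ ^ 2 := by
  rw [EuclideanSpace.norm_sq_eq]; rfl

theorem sqNorm_smul {X : Type*} [Fintype X] (c : ℂ) (ψ : X → ℂ) :
    sqNorm (c • ψ) = ‖c‖ ^ 2 * sqNorm ψ := by
  simp [sqNorm, mul_pow, Finset.mul_sum]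

theorem sqrt_sqNorm_sub_le {X : Type*} [Fintype X] (ψ φ : X → ℂ) :
    √(sqNorm (ψ - φ)) ≤ √(sqNorm ψ) + √(sqNorm φ) := by
  simp only [sqNorm_eq_norm_sq, Real.sqrt_sq (norm_nonneg _), WithLp.toLp_sub]
  exact norm_sub_le _ _

/-! ### Norm preservation, output probabilities and post-processing -/

namespace QueryAlgorithm

variable {I A Out : Type} [Fintype I] [DecidableEq I] [Fintype A] [DecidableEq A] [AddGroup A]
  {T : ℕ}

theorem sqNorm_state (alg : QueryAlgorithm I A Out T) (x : I → A) (t : ℕ) :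
    sqNorm (alg.state x t) = 1 := by
  induction t with
  | zero =>
    rw [state, sqNorm_eq_of_dotProduct_eq (unitary_dotProduct _ _ _)]
    simp [sqNorm, Pi.single_apply, apply_ite]
  | succ t ih =>
    rw [state, sqNorm_eq_of_dotProduct_eq (unitary_dotProduct _ _ _),
      sqNorm_eq_of_dotProduct_eq (queryOracle_dotProduct _ _ _), ih]

theorem prob_mono (alg : QueryAlgorithm I A Out T) (x : I → A) {S S' : Set Out} (h : S ⊆ S') :
    alg.prob x S ≤ alg.prob x S' := by
  refine Finset.sum_le_sum fun b _ => ?_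
  split_ifs with h1 h2
  · exact le_rfl
  · exact absurd (h h1) h2
  · positivity
  · exact le_rfl

theorem prob_add_prob_compl (alg : QueryAlgorithm I A Out T) (x : I → A) (S : Set Out) :
    alg.prob x S + alg.prob x Sᶜ = 1 := by
  rw [← alg.sqNorm_state x T, sqNorm, prob, prob, ← Finset.sum_add_distrib]
  refine Finset.sum_congr rfl fun b _ => ?_
  by_cases h : alg.output b ∈ S <;> simp [h]

/-- Post-processing of the answer. -/
def mapOutput {Out' : Type} (alg : QueryAlgorithm I A Out T) (g : Out → Out') :
    QueryAlgorithm I A Out' T where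
  Work := alg.Work
  start := alg.start
  U := alg.U
  output b := g (alg.output b)

theorem state_mapOutput {Out' : Type} (alg : QueryAlgorithm I A Out T) (g : Out → Out')
    (x : I → A) (t : ℕ) : (alg.mapOutput g).state x t = alg.state x t := by
  induction t with
  | zero => rfl
  | succ t ih => rw [state, ih]; rfl

theorem prob_mapOutput {Out' : Type} (alg : QueryAlgorithm I A Out T) (g : Out → Out')
    (x : I → A) (S : Set Out') : (alg.mapOutput g).prob x S = alg.prob x (g ⁻¹' S) := by
  rw [prob, state_mapOutput]; rfl

theorem Solves.mapOutput {Out' : Type} {alg : QueryAlgorithm I A Out T} {promise : Set (I → A)}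
    {accepted : (I → A) → Set Out} (h : alg.Solves promise accepted) (g : Out → Out')
    {accepted' : (I → A) → Set Out'}
    (hg : ∀ x ∈ promise, ∀ o ∈ accepted x, g o ∈ accepted' x) :
    (alg.mapOutput g).Solves promise accepted' := by
  intro x hx
  rw [prob_mapOutput]
  exact (h x hx).trans (alg.prob_mono x (hg x hx))

end QueryAlgorithm

/-! ### Algorithms from catalysts -/

/-- The basis state of the `t`-th copy of the answer register holding `l`. -/
def answerState {I A L W : Type} [AddGroup A] [DecidableEq A] [DecidableEq L] {T : ℕ}
    (p : Fin T × Option L) : Option I × A × ((Fin T × Option L) ⊕ W) → ℂ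
  | (none, a, Sum.inl q) => if a = 0 ∧ q = p then 1 else 0
  | _ => 0

/-- A catalyst vector, as a vector on the whole space. -/
def catalystState {I A L W : Type} {T : ℕ} (v : Option I × A × W → ℂ) : Option I × A × ((Fin T × Option L) ⊕ W) → ℂ
  | (i, a, Sum.inr w) => v (i, a, w)
  | _ => 0

theorem queryOracle_answerState {I A L W : Type} [AddGroup A] [DecidableEq A] [DecidableEq L]
    {T : ℕ} (x : I → A) (p : Fin T × Option L) :
    queryOracle x (answerState (W := W) p) = answerState p := by
  funext ⟨i, a, w⟩
  rcases i with _ | i <;> rcases w with w | w <;> rfl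

theorem queryOracle_catalystState {I A L W : Type} [AddGroup A] {T : ℕ} (x : I → A) (v : Option I × A × W → ℂ) :
    queryOracle x (catalystState (T := T) (L := L) v) = catalystState (queryOracle x v) := by
  funext ⟨i, a, w⟩
  rcases i with _ | i <;> rcases w with w | w <;> rfl

theorem sum_answerState_mul {I A L W : Type} [AddGroup A] [DecidableEq A] [DecidableEq L]
    [Fintype I] [Fintype A] [Fintype L] [Fintype W] {T : ℕ} (p : Fin T × Option L)
    (φ : Option I × A × ((Fin T × Option L) ⊕ W) → ℂ) :
    star (answerState p) ⬝ᵥ φ = φ (none, 0, Sum.inl p) := by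
  rw [dotProduct, Finset.sum_eq_single (none, 0, Sum.inl p)]
  · simp [answerState]
  · rintro ⟨_ | i, a, q | w⟩ _ h <;> simp [answerState]
    intro h1 h2
    simp [h1, h2] at h
  · simp

theorem sum_mul_answerState {I A L W : Type} [AddGroup A] [DecidableEq A] [DecidableEq L]
    [Fintype I] [Fintype A] [Fintype L] [Fintype W] {T : ℕ} (p : Fin T × Option L)
    (φ : Option I × A × ((Fin T × Option L) ⊕ W) → ℂ) :
    star φ ⬝ᵥ answerState p = star (φ (none, 0, Sum.inl p)) := by
  rw [← sum_answerState_mul p φ, Matrix.star_dotProduct]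

theorem catalystState_dotProduct {I A L W : Type} [Fintype I] [Fintype A] [Fintype L] [Fintype W]
    {T : ℕ} (v v' : Option I × A × W → ℂ) :
    star (catalystState (T := T) (L := L) v) ⬝ᵥ catalystState v' = star v ⬝ᵥ v' := by
  simp [dotProduct, Fintype.sum_prod_type, catalystState]

/-- The hypothesis is the Gram identity `1 + ⟨O v x, O v y⟩ = [leaf x = leaf y] + ⟨v x, v y⟩`. The
copies other than `t` are orthogonal to all vectors involved, so they can be required to stay fixed.
-/
theorem exists_unitary_catalystStep {I A L W : Type} [Fintype I] [DecidableEq I] [AddGroup A]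
    [Fintype A] [DecidableEq A] [Fintype L] [DecidableEq L] [Fintype W] [DecidableEq W] {T : ℕ}
    (leaf : (I → A) → L) (v : (I → A) → Option I × A × W → ℂ)
    (hv : ∀ x y, star (v x) ⬝ᵥ v y - star (queryOracle x (v x)) ⬝ᵥ queryOracle y (v y) =
      1 - if leaf x = leaf y then 1 else 0) (t : Fin T) :
    ∃ U : Matrix.unitaryGroup (Option I × A × ((Fin T × Option L) ⊕ W)) ℂ,
      (∀ x, U.1.mulVec (answerState (t, none) + catalystState (queryOracle x (v x))) =
        answerState (t, some (leaf x)) + catalystState (v x)) ∧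
      ∀ p : Fin T × Option L, p.1 ≠ t →
        U.1.mulVec (answerState p) = answerState p := by
  obtain ⟨U, hU⟩ := exists_unitary_of_gram_eq
    (ι := (I → A) ⊕ {p : Fin T × Option L // p.1 ≠ t})
    (X := Option I × A × ((Fin T × Option L) ⊕ W))
    (Sum.elim (fun x => answerState (t, none) + catalystState (queryOracle x (v x)))
      fun p => answerState p.1)
    (Sum.elim (fun x => answerState (t, some (leaf x)) + catalystState (v x))
      fun p => answerState p.1) (by
    rintro (x | ⟨⟨s, l⟩, hp⟩) (y | ⟨⟨s', l'⟩, hp'⟩)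
    · have := hv x y
      simp only [Sum.elim_inl, star_add, add_dotProduct, dotProduct_add, sum_answerState_mul,
        sum_mul_answerState, catalystState_dotProduct]
      simp only [answerState, catalystState, Prod.mk.injEq, Option.some.injEq, true_and, star_zero,
        if_true, eq_comm (a := leaf y)]
      have hstar : star (if leaf x = leaf y then (1 : ℂ) else 0) =
          if leaf x = leaf y then 1 else 0 := by split_ifs <;> simp
      linear_combination -this + star_one ℂ - hstar
    · have ht : t ≠ s' := Ne.symm hp'
      simp [answerState, catalystState, add_dotProduct, sum_mul_answerState, ht.symm]
    · have ht : t ≠ s := Ne.symm hp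
      simp [answerState, catalystState, dotProduct_add, sum_answerState_mul, ht.symm]
    · simp [sum_answerState_mul])
  exact ⟨U, fun x => hU (Sum.inl x), fun p hp => hU (Sum.inr ⟨p, hp⟩)⟩

/-- A family of catalysts whose Gram matrix changes under the oracle by the Gram matrix of the
answers yields a query algorithm. -/
theorem exists_queryAlgorithm_of_catalyst {I A Out L W : Type} [Fintype I] [DecidableEq I]
    [Fintype A] [DecidableEq A] [AddGroup A] [Fintype L] [DecidableEq L] [Fintype W]
    [DecidableEq W] (leaf : (I → A) → L) (out : L → Out) (v : (I → A) → Option I × A × W → ℂ)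
    (hv : ∀ x y, star (v x) ⬝ᵥ v y - star (queryOracle x (v x)) ⬝ᵥ queryOracle y (v y) =
      1 - if leaf x = leaf y then 1 else 0)
    (promise : Set (I → A)) (accepted : (I → A) → Set Out) {T : ℕ} (hT : 0 < T)
    (hnorm : ∀ x ∈ promise, 12 * sqNorm (v x) ≤ T)
    (hout : ∀ x ∈ promise, out (leaf x) ∈ accepted x) :
    ∃ alg : QueryAlgorithm I A Out T, alg.Solves promise accepted := by
  choose V hV hV' using exists_unitary_catalystStep (T := T) leaf v hv
  -- The amplitude that normalizes the uniform superposition of the `T` copies.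
  set c : ℂ := ((√T : ℝ) : ℂ)⁻¹ with hc
  have hc2 : ‖c‖ ^ 2 = (T : ℝ)⁻¹ := by
    rw [hc, norm_inv, Complex.norm_real, Real.norm_of_nonneg (Real.sqrt_nonneg _), inv_pow,
      Real.sq_sqrt (Nat.cast_nonneg _)]
  have hT' : (T : ℝ) ≠ 0 := by positivity
  let start : Option I × A × ((Fin T × Option L) ⊕ W) := (none, 0, Sum.inl (⟨0, hT⟩, none))
  obtain ⟨U₀, hU₀⟩ := exists_unitary_of_gram_eq (ι := Unit)
    (X := Option I × A × ((Fin T × Option L) ⊕ W)) (fun _ => Pi.single start 1)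
    (fun _ => c • ∑ s : Fin T, answerState (s, none)) (by
      intro _ _
      have : (star c * c) * T = 1 := by
        have : star c * c = ((‖c‖ ^ 2 : ℝ) : ℂ) := by
          rw [← starRingEnd_apply, RCLike.conj_mul]; push_cast; rfl
        rw [this, hc2]; push_cast; exact inv_mul_cancel₀ (by exact_mod_cast hT')
      rw [star_smul, smul_dotProduct, dotProduct_smul, star_sum, sum_dotProduct]
      simp only [sum_answerState_mul, Finset.sum_apply]
      simp [answerState]
      simp only [Complex.star_def] at *
      linear_combination -this)
  let alg : QueryAlgorithm I A Out T :=
    { Work := (Fin T × Option L) ⊕ W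
      start := start
      U := fun t => match t with
        | 0 => U₀
        | t + 1 => if h : t < T then V ⟨t, h⟩ else 1
      -- Outcomes outside the answered copies get an arbitrary output; they are counted as errors or
      -- help by accident.
      output := fun b => match b with
        | (_, _, Sum.inl (_, some l)) => out l
        | _ => out (leaf 0) }
  refine ⟨alg, fun x hx => ?_⟩
  -- The ideal state, up to the factor `c`: the first `t` copies are answered and the catalyst is
  -- present.
  let S : ℕ → Option I × A × ((Fin T × Option L) ⊕ W) → ℂ := fun t =>
    (∑ s : Fin T, answerState (s, if (s : ℕ) < t then some (leaf x) else none)) + catalystState (v x)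
  have hstep : ∀ t (ht : t < T),
      (V ⟨t, ht⟩).1.mulVec (queryOracle x (S t)) = S (t + 1) := by
    intro t ht
    have key : ∀ k, S k = answerState (⟨t, ht⟩, if t < k then some (leaf x) else none) +
        catalystState (v x) + ∑ s ∈ Finset.univ.erase (⟨t, ht⟩ : Fin T),
          answerState (s, if (s : ℕ) < k then some (leaf x) else none) := by
      intro k
      simp only [S]
      rw [← Finset.add_sum_erase _ _ (Finset.mem_univ (⟨t, ht⟩ : Fin T))]
      abel
    have hO : queryOracle x (S t) = answerState (⟨t, ht⟩, none) +
        catalystState (queryOracle x (v x)) + ∑ s ∈ Finset.univ.erase (⟨t, ht⟩ : Fin T),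
          answerState (s, if (s : ℕ) < t then some (leaf x) else none) := by
      rw [key]
      simp only [queryOracle_add, queryOracle_catalystState, queryOracle_answerState, lt_irrefl,
        if_false]
      congr 1
      rw [queryOracle_eq_comp]
      funext b
      simp only [Function.comp_apply, Finset.sum_apply]
      refine Finset.sum_congr rfl fun s _ => ?_
      exact congrFun ((queryOracle_eq_comp x _).symm.trans (queryOracle_answerState x _)) b
    rw [hO, key, Matrix.mulVec_add, hV, Matrix.mulVec_sum]
    congr 1
    · simp
    · refine Finset.sum_congr rfl fun s hs => ?_
      have hst : s ≠ ⟨t, ht⟩ := Finset.ne_of_mem_erase hs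
      have hst' : (s : ℕ) ≠ t := fun h => hst (Fin.ext h)
      rw [hV' _ _ hst]
      congr 2
      simp only [show (s : ℕ) < t + 1 ↔ (s : ℕ) < t by omega]
  -- Real and ideal state undergo the same norm-preserving steps, so they differ throughout by as
  -- much as at the start, where only the catalyst is missing.
  have hdist : ∀ t ≤ T, sqNorm (alg.state x t - c • S t) = (T : ℝ)⁻¹ * sqNorm (v x) := by
    intro t
    induction t with
    | zero =>
      intro _
      have : alg.state x 0 - c • S 0 = (-c) • catalystState (v x) := by
        have h0 : alg.state x 0 = c • ∑ s : Fin T, answerState (s, none) := hU₀ ()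
        rw [h0]
        simp only [S, not_lt_zero, if_false, smul_add, neg_smul]
        abel
      rw [this, sqNorm_smul, norm_neg, hc2, sqNorm_eq_of_dotProduct_eq (catalystState_dotProduct _ _)]
    | succ t ih =>
      intro ht
      have hU : alg.U (t + 1) = V ⟨t, ht⟩ := dif_pos (show t < T from ht)
      have : alg.state x (t + 1) - c • S (t + 1) = (V ⟨t, ht⟩).1.mulVec
          (queryOracle x (alg.state x t - c • S t)) := by
        have h1 : ∀ k, alg.state x k - c • S k = alg.state x k + (-c) • S k := fun k => by
          rw [neg_smul, sub_eq_add_neg]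
        rw [h1, h1, queryOracle_add, queryOracle_smul, Matrix.mulVec_add, Matrix.mulVec_smul,
          hstep t ht]
        congr 1
        rw [← hU]
        rfl
      rw [this, sqNorm_eq_of_dotProduct_eq (unitary_dotProduct _ _ _),
        sqNorm_eq_of_dotProduct_eq (queryOracle_dotProduct _ _ _), ih (by omega)]
  set τ : Option I × A × ((Fin T × Option L) ⊕ W) → ℂ :=
    c • ∑ s : Fin T, answerState (s, some (leaf x)) with hτ
  -- The catalyst counts twice: missing at the start, left over at the end. The distance is at most
  -- `2 ‖v x‖ / √T`, and the factor `12` makes its square at most `4 / 12`.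
  have hclose : sqNorm (alg.state x T - τ) ≤ 1 / 3 := by
    have hST : c • S T = τ + c • catalystState (v x) := by
      simp only [S, Fin.is_lt, if_true, smul_add, hτ]
    have h1 : alg.state x T - τ = (alg.state x T - c • S T) - (-c) • catalystState (v x) := by
      rw [hST, neg_smul]; abel
    have h2 := sqrt_sqNorm_sub_le (alg.state x T - c • S T) ((-c) • catalystState (v x))
    rw [← h1, hdist T le_rfl, sqNorm_smul, norm_neg, hc2,
      sqNorm_eq_of_dotProduct_eq (catalystState_dotProduct _ _), ← two_mul] at h2
    have h3 : (T : ℝ)⁻¹ * sqNorm (v x) ≤ 1 / 12 := by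
      rw [inv_mul_le_iff₀ (by positivity)]
      linarith [hnorm x hx]
    have h0 : ∀ {X : Type} [Fintype X] (ψ : X → ℂ), 0 ≤ sqNorm ψ := fun ψ =>
      Finset.sum_nonneg fun _ _ => by positivity
    have h4 := pow_le_pow_left₀ (Real.sqrt_nonneg _) h2 2
    rw [mul_pow, Real.sq_sqrt (h0 _), Real.sq_sqrt (mul_nonneg (by positivity) (h0 _))] at h4
    linarith
  -- The target `τ` vanishes on wrong outcomes, so their probability is part of the squared
  -- distance.
  have hcompl : alg.prob x (accepted x)ᶜ ≤ sqNorm (alg.state x T - τ) := by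
    refine Finset.sum_le_sum fun b _ => ?_
    split_ifs with hb
    · have : τ b = 0 := by
        rw [hτ, Pi.smul_apply, Finset.sum_apply, Finset.sum_eq_zero, smul_zero]
        intro s _
        rcases b with ⟨_ | i, a, ⟨q, _ | l⟩ | w⟩
        · simp [answerState]
        · have hl : l ≠ leaf x := by
            rintro rfl
            exact hb (hout x hx)
          simp [answerState, hl]
        all_goals rfl
      rw [Pi.sub_apply, this, sub_zero]
    · positivity
  linarith [alg.prob_add_prob_compl x (accepted x)]

/-! ### Weighted decision trees -/

/-- A decision tree.  Every query comes with a set `blk` of expected answers, which all lead to the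
same continuation, and with the number `m` of times that an expected answer is tolerated. -/
inductive DecisionTree (I A Out : Type) : Type
  | ret (o : Out) : DecisionTree I A Out
  | query (i : I) (blk : A → Bool) (m : ℕ) (b : DecisionTree I A Out)
      (r : A → DecisionTree I A Out) : DecisionTree I A Out

namespace DecisionTree

variable {I A Out : Type}

/-- The answer computed by a decision tree. -/
def eval (x : I → A) : DecisionTree I A Out → Out
  | ret o => o
  | query i blk _ b r => if blk (x i) then b.eval x else (r (x i)).eval x

/-- The cost of a run: `1 / √(m + 1)` for an expected answer, `√(m + 1) + 1` for any other. -/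
noncomputable def cost (x : I → A) : DecisionTree I A Out → ℝ
  | ret _ => 0
  | query i blk m b r =>
    if blk (x i) then 1 / √(m + 1) + b.cost x else √(m + 1) + 1 + (r (x i)).cost x

end DecisionTree

/-- The vector `∑ k, coef k |i, pos k, k⟩`. -/
def localState {I A K : Type} [DecidableEq I] [DecidableEq A] (i : I) (pos : K → A)
    (coef : K → ℝ) : Option I × A × K → ℂ :=
  fun b => if b.1 = some i ∧ b.2.1 = pos b.2.2 then (coef b.2.2 : ℂ) else 0

theorem localState_dotProduct {I A K : Type} [Fintype I] [DecidableEq I] [Fintype A]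
    [DecidableEq A] [Fintype K] (i : I) (pos pos' : K → A) (coef coef' : K → ℝ) :
    star (localState i pos coef) ⬝ᵥ localState i pos' coef' =
      ∑ k, if pos k = pos' k then (coef k * coef' k : ℂ) else 0 := by
  rw [dotProduct, Fintype.sum_prod_type, Finset.sum_eq_single (some i) _ (by simp),
    Fintype.sum_prod_type_right]
  · refine Finset.sum_congr rfl fun k _ => ?_
    rw [Finset.sum_eq_single (pos k)]
    · simp [localState]
    · intro a _ ha
      simp [localState, ha]
    · simp
  · intro j _ hj
    simp [localState, hj]

theorem queryOracle_localState {I A K : Type} [DecidableEq I] [DecidableEq A] [AddGroup A]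
    (x : I → A) (i : I) (pos : K → A) (coef : K → ℝ) :
    queryOracle x (localState i pos coef) = localState i (fun k => pos k + x i) coef := by
  funext ⟨j, a, k⟩
  rcases j with _ | j
  · simp [queryOracle, localState]
  · rcases eq_or_ne j i with rfl | h
    · simp [queryOracle, localState, sub_eq_iff_eq_add]
    · simp [queryOracle, localState, h]

/-- The part of a vector in which the work register lies in the image of `g`. -/
def restrictWork {J A W W' : Type} (g : W → W') (ψ : J × A × W' → ℂ) : J × A × W → ℂ :=
  fun b => ψ (b.1, b.2.1, g b.2.2)

theorem queryOracle_restrictWork {I A W W' : Type} [AddGroup A] (x : I → A) (g : W → W')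
    (ψ : Option I × A × W' → ℂ) :
    queryOracle x (restrictWork g ψ) = restrictWork g (queryOracle x ψ) := by
  funext ⟨j, a, w⟩
  cases j <;> rfl

theorem dotProduct_restrictWork_sum {J A W W' : Type} [Fintype J] [Fintype A] [Fintype W]
    [Fintype W'] (ψ φ : J × A × (W ⊕ W') → ℂ) :
    star ψ ⬝ᵥ φ = star (restrictWork Sum.inl ψ) ⬝ᵥ restrictWork Sum.inl φ +
      star (restrictWork Sum.inr ψ) ⬝ᵥ restrictWork Sum.inr φ := by
  simp [dotProduct, Fintype.sum_prod_type, restrictWork, Finset.sum_add_distrib]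

theorem dotProduct_restrictWork_sigma {J A C : Type} {W : C → Type} [Fintype J] [Fintype A]
    [Fintype C] [∀ c, Fintype (W c)] (ψ φ : J × A × (Σ c, W c) → ℂ) :
    star ψ ⬝ᵥ φ = ∑ c, star (restrictWork (Sigma.mk c) ψ) ⬝ᵥ restrictWork (Sigma.mk c) φ := by
  simp only [dotProduct, Fintype.sum_prod_type, restrictWork, Fintype.sum_sigma]
  symm
  rw [Finset.sum_comm]
  refine Finset.sum_congr rfl fun j _ => ?_
  rw [Finset.sum_comm]
  rfl

/-- The inner product of two catalysts minus that of their images under the oracle. -/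
noncomputable def gramDiff {I A W : Type} [Fintype I] [Fintype A] [AddGroup A] [Fintype W]
    (v : (I → A) → Option I × A × W → ℂ) (x y : I → A) : ℂ :=
  star (v x) ⬝ᵥ v y - star (queryOracle x (v x)) ⬝ᵥ queryOracle y (v y)

theorem gramDiff_sum {I A W W' : Type} [Fintype I] [Fintype A] [AddGroup A] [Fintype W]
    [Fintype W'] (v : (I → A) → Option I × A × (W ⊕ W') → ℂ) (x y : I → A) :
    gramDiff v x y = gramDiff (fun x => restrictWork Sum.inl (v x)) x y +
      gramDiff (fun x => restrictWork Sum.inr (v x)) x y := by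
  simp only [gramDiff, queryOracle_restrictWork]
  rw [dotProduct_restrictWork_sum, dotProduct_restrictWork_sum (queryOracle x (v x))]
  ring

theorem gramDiff_sigma {I A C : Type} {W : C → Type} [Fintype I] [Fintype A] [AddGroup A]
    [Fintype C] [∀ c, Fintype (W c)] (v : (I → A) → Option I × A × (Σ c, W c) → ℂ)
    (x y : I → A) :
    gramDiff v x y = ∑ c, gramDiff (fun x => restrictWork (Sigma.mk c) (v x)) x y := by
  simp only [gramDiff, queryOracle_restrictWork]
  rw [dotProduct_restrictWork_sigma, dotProduct_restrictWork_sigma (queryOracle x (v x)),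
    ← Finset.sum_sub_distrib]

theorem queryOracle_zero {I A W : Type} [AddGroup A] (x : I → A) :
    queryOracle x (0 : Option I × A × W → ℂ) = 0 := by
  rw [queryOracle_eq_comp]; rfl

/-- A subtree's catalyst, switched on only for inputs that enter the subtree, affects only pairs
that both enter it. -/
theorem gramDiff_ite {I A W : Type} [Fintype I] [Fintype A] [AddGroup A] [Fintype W]
    (P : (I → A) → Prop) [DecidablePred P] (v : (I → A) → Option I × A × W → ℂ) (x y : I → A) :
    gramDiff (fun x => if P x then v x else 0) x y = if P x ∧ P y then gramDiff v x y else 0 := by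
  by_cases hx : P x <;> by_cases hy : P y <;> simp [gramDiff, hx, hy, queryOracle_zero]

theorem sqNorm_sum {J A W W' : Type} [Fintype J] [Fintype A] [Fintype W]
    [Fintype W'] (ψ : J × A × (W ⊕ W') → ℂ) :
    sqNorm ψ = sqNorm (restrictWork Sum.inl ψ) + sqNorm (restrictWork Sum.inr ψ) := by
  have := dotProduct_restrictWork_sum ψ ψ
  simp only [dotProduct_star_self] at this
  exact_mod_cast this

theorem sqNorm_sigma {J A C : Type} {W : C → Type} [Fintype J] [Fintype A]
    [Fintype C] [∀ c, Fintype (W c)] (ψ : J × A × (Σ c, W c) → ℂ) :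
    sqNorm ψ = ∑ c, sqNorm (restrictWork (Sigma.mk c) ψ) := by
  have := dotProduct_restrictWork_sigma ψ ψ
  simp only [dotProduct_star_self] at this
  exact_mod_cast this

theorem sqNorm_zero {X : Type*} [Fintype X] : sqNorm (0 : X → ℂ) = 0 := by simp [sqNorm]

/-- The amplitudes of the catalyst at a query, after an expected and after an unexpected answer. -/
noncomputable def queryCoef (s : ℝ) (black : Bool) : Fin 3 → ℝ :=
  if black then ![s, 0, s] else ![1 / (2 * s), 1, -(1 / (2 * s))]

/-- The register contents of the catalyst at a query. -/
def queryPos {A : Type} [AddGroup A] (c : A) : Fin 3 → A := ![0, 0, -c]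

/-- For different answers, the first two slots agree only before the query and the third only after
it, so the difference is `c₀ c₀' + c₁ c₁' - c₂ c₂'`. This is `s² - s² = 0` for two expected answers,
`1/2 + 1/2` for a mixed pair, and `1` from the middle slot for two unexpected ones. -/
theorem gramDiff_localState {I A : Type} [Fintype I] [DecidableEq I] [Fintype A] [DecidableEq A]
    [AddGroup A] (i : I) (blk : A → Bool) {s : ℝ} (hs : s ≠ 0) (x y : I → A) :
    gramDiff (fun x => localState i (queryPos (x i)) (queryCoef s (blk (x i)))) x y =
      if x i = y i ∨ (blk (x i) ∧ blk (y i)) then 0 else 1 := by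
  have hs' : (s : ℂ) ≠ 0 := by exact_mod_cast hs
  have h3 : (-x i = -y i) ↔ x i = y i := neg_inj
  simp only [gramDiff, queryOracle_localState, localState_dotProduct, Fin.sum_univ_three,
    queryPos, queryCoef]
  by_cases h : x i = y i
  · simp [h]
  · cases hx : blk (x i) <;> cases hy : blk (y i) <;> simp [h]
    all_goals field_simp
    all_goals ring

theorem sqNorm_localState {I A : Type} [Fintype I] [DecidableEq I] [Fintype A] [DecidableEq A]
    (i : I) {K : Type} [Fintype K] (pos : K → A) (coef : K → ℝ) :
    sqNorm (localState i pos coef) = ∑ k, coef k ^ 2 := by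
  have := localState_dotProduct i pos pos coef coef
  simp only [dotProduct_star_self, if_true] at this
  have h2 : sqNorm (localState i pos coef) = ∑ k, coef k * coef k := by exact_mod_cast this
  simpa only [sq] using h2

/-- Every decision tree has a catalyst, whose squared norm is the cost of the run. -/
theorem DecisionTree.exists_catalyst {I A Out : Type} [Fintype I] [DecidableEq I] [Fintype A]
    [DecidableEq A] [AddGroup A] (tree : DecisionTree I A Out) :
    ∃ (L W : Type) (_ : Fintype L) (_ : DecidableEq L) (_ : Fintype W) (_ : DecidableEq W)
      (leaf : (I → A) → L) (out : L → Out) (v : (I → A) → Option I × A × W → ℂ),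
      (∀ x, out (leaf x) = tree.eval x) ∧
      (∀ x y, gramDiff v x y = 1 - if leaf x = leaf y then 1 else 0) ∧
      ∀ x, sqNorm (v x) = tree.cost x := by
  induction tree with
  | ret o =>
    refine ⟨Unit, Empty, inferInstance, inferInstance, inferInstance, inferInstance, fun _ => (),
      fun _ => o, fun _ _ => 0, fun _ => rfl, fun x y => ?_, fun x => ?_⟩
    · simp [gramDiff, dotProduct]
    · simp [sqNorm, cost]
  | query i blk m b r ihb ihr =>
    obtain ⟨Lb, Wb, _, _, _, _, leafb, outb, vb, hb1, hb2, hb3⟩ := ihb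
    choose Lr Wr fL dL fW dW leafr outr vr hr1 hr2 hr3 using ihr
    -- Chosen so that `2 s² = 1 / √(m + 1)` and `1 / (2 s²) = √(m + 1)`, the two weights in `cost`.
    set s : ℝ := √(1 / √(m + 1) / 2) with hs
    have hm : (0 : ℝ) < √(m + 1) := Real.sqrt_pos.2 (by positivity)
    have hs0 : s ≠ 0 := (Real.sqrt_pos.2 (by positivity)).ne'
    have hs2 : s ^ 2 = 1 / √(m + 1) / 2 := Real.sq_sqrt (by positivity)
    let v : (I → A) → Option I × A × (Fin 3 ⊕ (Wb ⊕ Σ c, Wr c)) → ℂ := fun x q =>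
      match q with
      | (j, a, Sum.inl k) => localState i (queryPos (x i)) (queryCoef s (blk (x i))) (j, a, k)
      | (j, a, Sum.inr (Sum.inl w)) => if blk (x i) then vb x (j, a, w) else 0
      | (j, a, Sum.inr (Sum.inr ⟨c, w⟩)) =>
        if blk (x i) = false ∧ x i = c then vr c x (j, a, w) else 0
    have v1 : ∀ x, restrictWork Sum.inl (v x) =
        localState i (queryPos (x i)) (queryCoef s (blk (x i))) := fun x => rfl
    have v2 : ∀ x, restrictWork Sum.inl (restrictWork Sum.inr (v x)) =
        if blk (x i) then vb x else 0 := fun x => by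
      funext q
      simp only [restrictWork, v]
      split_ifs <;> rfl
    have v3 : ∀ c x, restrictWork (Sigma.mk c) (restrictWork Sum.inr (restrictWork Sum.inr (v x))) =
        if blk (x i) = false ∧ x i = c then vr c x else 0 := fun c x => by
      funext q
      simp only [restrictWork, v]
      split_ifs <;> rfl
    refine ⟨Lb ⊕ Σ c, Lr c, Fin 3 ⊕ (Wb ⊕ Σ c, Wr c), inferInstance, inferInstance, inferInstance,
      inferInstance, fun x => if blk (x i) then Sum.inl (leafb x) else
        Sum.inr ⟨x i, leafr (x i) x⟩, Sum.elim outb fun p => outr p.1 p.2, v, ?_, ?_, ?_⟩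
    · intro x
      cases h : blk (x i) <;> simp [eval, h, hb1, hr1]
    · intro x y
      rw [gramDiff_sum, gramDiff_sum (fun x => restrictWork Sum.inr (v x)), gramDiff_sigma]
      simp only [v1, v2, v3]
      rw [gramDiff_localState i blk hs0]
      simp only [gramDiff_ite, hb2, hr2]
      -- Either the runs separate at this query, and the local term contributes the whole `1`, or
      -- they continue in the same subtree, and only its catalyst contributes.
      rcases Bool.eq_false_or_eq_true (blk (x i)) with hx | hx <;>
        rcases Bool.eq_false_or_eq_true (blk (y i)) with hy | hy
      · simp [hx, hy]
      · have h : x i ≠ y i := fun h => by simp [h, hy] at hx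
        simp [hx, hy, h]
      · have h : x i ≠ y i := fun h => by simp [h, hy] at hx
        simp [hx, hy, h]
      · by_cases h : x i = y i
        · have h' : ∀ c, x i = c ∧ y i = c ↔ y i = c := fun c => by simp [h]
          have hl : (Sigma.mk (β := Lr) (x i) (leafr (x i) x) = ⟨y i, leafr (y i) y⟩) ↔
              leafr (y i) x = leafr (y i) y := by rw [h]; simp
          simp [hx, hy, h', hl]
          simp [h]
        · have : ∀ c, ¬ (x i = c ∧ y i = c) := fun c hc => h (hc.1.trans hc.2.symm)
          simp [hx, hy, h, this]
    · intro x
      rw [sqNorm_sum, sqNorm_sum (restrictWork Sum.inr (v x)), sqNorm_sigma]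
      simp only [v1, v2, v3, sqNorm_localState, Fin.sum_univ_three, queryCoef, cost]
      cases hx : blk (x i)
      · simp only [Bool.false_eq_true, if_false, true_and, apply_ite sqNorm, sqNorm_zero, hr3]
        rw [Finset.sum_ite_eq]
        simp
        have : ((s * 2) ^ 2)⁻¹ = √(m + 1) / 2 := by
          rw [mul_pow, hs2]
          field_simp
        rw [← mul_inv, inv_pow, this]
        ring
      · simp [hb3, sqNorm_zero, hs2]

/-- A decision tree of bounded cost yields a quantum query algorithm. -/
theorem DecisionTree.exists_queryAlgorithm {I A Out : Type} [Fintype I] [DecidableEq I] [Fintype A]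
    [DecidableEq A] [AddGroup A] (tree : DecisionTree I A Out) (promise : Set (I → A))
    (accepted : (I → A) → Set Out) {T : ℕ} (hT : 0 < T)
    (hcost : ∀ x ∈ promise, 12 * tree.cost x ≤ T)
    (heval : ∀ x ∈ promise, tree.eval x ∈ accepted x) :
    ∃ alg : QueryAlgorithm I A Out T, alg.Solves promise accepted := by
  obtain ⟨L, W, _, _, _, _, leaf, out, v, h1, h2, h3⟩ := tree.exists_catalyst
  exact exists_queryAlgorithm_of_catalyst leaf out v h2 promise accepted hT
    (fun x hx => by rw [h3]; exact hcost x hx) (fun x hx => by rw [h1]; exact heval x hx)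

/-! ### A decision tree that finds a spanning tree -/

namespace SpanningTreeSearch

variable {n : ℕ} {d : Fin n → ℕ}

/-- The total degree of a set of vertices. -/
def totalDegree (d : Fin n → ℕ) (C : Finset (Fin n)) : ℕ := ∑ v ∈ C, d v

/-- The array positions of a set of vertices. -/
noncomputable def positions (d : Fin n → ℕ) (C : Finset (Fin n)) : List (ArrayIndex n d) :=
  (C.sigma fun _ => Finset.univ).toList

theorem length_positions (C : Finset (Fin n)) : (positions d C).length = totalDegree d C := by
  simp [positions, totalDegree]

theorem mem_positions {C : Finset (Fin n)} {i : ArrayIndex n d} :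
    i ∈ positions d C ↔ i.1 ∈ C := by
  simp [positions]

theorem nodup_positions (C : Finset (Fin n)) : (positions d C).Nodup := Finset.nodup_toList _

/-- The part of a partition that contains `a`. -/
def partOf (P : Finset (Finset (Fin n))) (a : Fin n) : Finset (Fin n) :=
  (P.filter (a ∈ ·)).sup id

/-- The partition with two parts merged. -/
def merge (P : Finset (Finset (Fin n))) (C C' : Finset (Fin n)) : Finset (Finset (Fin n)) :=
  insert (C ∪ C') ((P.erase C).erase C')

/-- `P` is a partition of the vertices into sets that are connected in the known part `H` of the
graph `G`. -/
structure IsComponents (G H : SimpleGraph (Fin n)) (P : Finset (Finset (Fin n))) : Prop where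
  le : H ≤ G
  nonempty : ∀ C ∈ P, C.Nonempty
  reachable : ∀ C ∈ P, ∀ u ∈ C, ∀ v ∈ C, H.Reachable u v
  eq_of_mem : ∀ C ∈ P, ∀ C' ∈ P, ∀ v, v ∈ C → v ∈ C' → C = C'
  cover : ∀ v, ∃ C ∈ P, v ∈ C

/-! ### Partitions into connected parts and their merging -/

namespace IsComponents

variable {G H : SimpleGraph (Fin n)} {P : Finset (Finset (Fin n))}

theorem partOf_eq (h : IsComponents G H P) {C : Finset (Fin n)} (hC : C ∈ P) {a : Fin n}
    (ha : a ∈ C) : partOf P a = C := by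
  have : P.filter (a ∈ ·) = {C} := by
    ext C'
    simp only [Finset.mem_filter, Finset.mem_singleton]
    constructor
    · rintro ⟨h1, h2⟩
      exact h.eq_of_mem _ h1 _ hC a h2 ha
    · rintro rfl
      exact ⟨hC, ha⟩
  rw [partOf, this, Finset.sup_singleton, id]

theorem partOf_mem (h : IsComponents G H P) (a : Fin n) : partOf P a ∈ P := by
  obtain ⟨C, hC, ha⟩ := h.cover a
  rwa [h.partOf_eq hC ha]

theorem mem_partOf (h : IsComponents G H P) (a : Fin n) : a ∈ partOf P a := by
  obtain ⟨C, hC, ha⟩ := h.cover a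
  rwa [h.partOf_eq hC ha]

theorem disjoint (h : IsComponents G H P) {C C' : Finset (Fin n)} (hC : C ∈ P) (hC' : C' ∈ P)
    (hne : C ≠ C') : Disjoint C C' :=
  Finset.disjoint_left.2 fun v hv hv' => hne (h.eq_of_mem _ hC _ hC' v hv hv')

theorem merge (h : IsComponents G H P) {C C' : Finset (Fin n)} (hC : C ∈ P) (hC' : C' ∈ P)
    {u a : Fin n} (hu : u ∈ C) (ha : a ∈ C') (hG : G.Adj u a) :
    IsComponents G (H ⊔ SimpleGraph.edge u a) (merge P C C') := by
  have hle : H ≤ H ⊔ SimpleGraph.edge u a := le_sup_left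
  have hadj : (H ⊔ SimpleGraph.edge u a).Reachable u a := by
    refine SimpleGraph.Adj.reachable ?_
    rw [SimpleGraph.sup_adj, SimpleGraph.edge_adj]
    exact Or.inr ⟨Or.inl ⟨rfl, rfl⟩, hG.ne⟩
  have hmem : ∀ D, D ∈ SpanningTreeSearch.merge P C C' → D = C ∪ C' ∨ (D ∈ P ∧ D ≠ C ∧ D ≠ C') := by
    intro D hD
    simp only [SpanningTreeSearch.merge, Finset.mem_insert, Finset.mem_erase] at hD
    tauto
  refine ⟨sup_le h.le ?_, ?_, ?_, ?_, ?_⟩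
  · intro v w hvw
    rw [SimpleGraph.edge_adj] at hvw
    rcases hvw with ⟨⟨rfl, rfl⟩ | ⟨rfl, rfl⟩, _⟩
    · exact hG
    · exact hG.symm
  · intro D hD
    rcases hmem D hD with rfl | ⟨hD, _⟩
    · exact ⟨u, Finset.mem_union_left _ hu⟩
    · exact h.nonempty D hD
  · intro D hD v hv w hw
    rcases hmem D hD with rfl | ⟨hD, _⟩
    · have key : ∀ z ∈ C ∪ C', (H ⊔ SimpleGraph.edge u a).Reachable z u := by
        intro z hz
        rcases Finset.mem_union.1 hz with hz | hz
        · exact (h.reachable _ hC _ hz _ hu).mono hle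
        · exact ((h.reachable _ hC' _ hz _ ha).mono hle).trans hadj.symm
      exact (key v hv).trans (key w hw).symm
    · exact (h.reachable _ hD _ hv _ hw).mono hle
  · have key : ∀ D ∈ P, D ≠ C → D ≠ C' → ∀ v ∈ D, v ∉ C ∪ C' := by
      intro D hD h1 h2 v hv hv'
      rcases Finset.mem_union.1 hv' with hv' | hv'
      · exact h1 (h.eq_of_mem _ hD _ hC v hv hv')
      · exact h2 (h.eq_of_mem _ hD _ hC' v hv hv')
    intro D hD D' hD' v hv hv'
    rcases hmem D hD with rfl | ⟨hD, h1, h2⟩ <;> rcases hmem D' hD' with rfl | ⟨hD', h1', h2'⟩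
    · rfl
    · exact absurd hv (key D' hD' h1' h2' v hv')
    · exact absurd hv' (key D hD h1 h2 v hv)
    · exact h.eq_of_mem _ hD _ hD' v hv hv'
  · intro v
    obtain ⟨D, hD, hv⟩ := h.cover v
    by_cases h1 : D = C ∨ D = C'
    · refine ⟨C ∪ C', Finset.mem_insert_self _ _, ?_⟩
      rcases h1 with rfl | rfl
      · exact Finset.mem_union_left _ hv
      · exact Finset.mem_union_right _ hv
    · push Not at h1
      exact ⟨D, Finset.mem_insert_of_mem
        (Finset.mem_erase.2 ⟨h1.2, Finset.mem_erase.2 ⟨h1.1, hD⟩⟩), hv⟩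

theorem sum_card (h : IsComponents G H P) : ∑ C ∈ P, C.card = n := by
  rw [← Finset.card_biUnion fun C hC C' hC' hne => h.disjoint hC hC' hne]
  have : P.biUnion (fun C => C) = Finset.univ := by
    ext v
    simpa using h.cover v
  rw [this, Finset.card_univ, Fintype.card_fin]

theorem connected [NeZero n] (h : IsComponents G H P) (hP : P.card ≤ 1) : H.Connected := by
  have : Nonempty (Fin n) := ⟨0⟩
  refine (SimpleGraph.connected_iff _).2 ⟨fun u v => ?_, this⟩
  obtain ⟨C, hC, hu⟩ := h.cover u
  obtain ⟨C', hC', hv⟩ := h.cover v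
  obtain rfl := Finset.card_le_one.1 hP C hC C' hC'
  exact h.reachable C hC u hu v hv

theorem not_connected (h : IsComponents G H P) {C : Finset (Fin n)} (hC : C ∈ P)
    (hP : 1 < P.card) (hclosed : ∀ u ∈ C, ∀ v, G.Adj u v → v ∈ C) : ¬ G.Connected := by
  intro hG
  obtain ⟨C', hC', hne⟩ := Finset.exists_mem_ne hP C
  obtain ⟨u, hu⟩ := h.nonempty C hC
  obtain ⟨v, hv⟩ := h.nonempty C' hC'
  obtain ⟨w⟩ := hG.preconnected u v
  have key : ∀ a b, G.Walk a b → a ∈ C → b ∈ C := by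
    intro a b w
    induction w with
    | nil => exact id
    | cons hadj _ ih => exact fun ha => ih (hclosed _ ha _ hadj)
  exact hne (h.eq_of_mem _ hC' _ hC v hv (key u v w hu))

end IsComponents

theorem card_merge_lt {P : Finset (Finset (Fin n))} {C C' : Finset (Fin n)} (hC : C ∈ P)
    (hC' : C' ∈ P) (hne : C ≠ C') : (merge P C C').card < P.card := by
  have h1 := Finset.card_insert_le (C ∪ C') ((P.erase C).erase C')
  have h2 := Finset.card_erase_add_one hC
  have h3 := Finset.card_erase_add_one (Finset.mem_erase.2 ⟨hne.symm, hC'⟩)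
  unfold merge
  omega

/-! #### The potential -/

/-- The sum of the square roots of the total degrees of the parts. -/
noncomputable def potential (d : Fin n → ℕ) (P : Finset (Finset (Fin n))) : ℝ :=
  ∑ C ∈ P, √(totalDegree d C)

/-- The square of the right side is `b + √a √b + a / 4`, and `√a √b ≥ a`. -/
theorem sqrt_add_le_sqrt_add_half_sqrt {a b : ℝ} (ha : 0 ≤ a) (hab : a ≤ b) :
    √(a + b) ≤ √b + √a / 2 := by
  have hb : 0 ≤ b := ha.trans hab
  have h1 := Real.sq_sqrt ha
  have h2 := Real.sq_sqrt hb
  have h3 := Real.sqrt_le_sqrt hab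
  have h4 := Real.sqrt_nonneg a
  rw [Real.sqrt_le_left (by positivity)]
  nlinarith

theorem potential_merge_le {P : Finset (Finset (Fin n))} {C C' : Finset (Fin n)} (hC : C ∈ P)
    (hC' : C' ∈ P) (hne : C ≠ C') (hle : totalDegree d C ≤ totalDegree d C') :
    potential d (merge P C C') + √(totalDegree d C) / 2 ≤ potential d P := by
  have h1 : potential d (merge P C C') ≤
      √(totalDegree d (C ∪ C')) + ∑ D ∈ (P.erase C).erase C', √(totalDegree d D) := by
    unfold potential merge
    -- The family `P` is not assumed to be a partition here, so the union may already belong to it.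
    by_cases h : C ∪ C' ∈ (P.erase C).erase C'
    · rw [Finset.insert_eq_of_mem h]
      linarith [Real.sqrt_nonneg (totalDegree d (C ∪ C'))]
    · rw [Finset.sum_insert h]
  have h2 := Finset.add_sum_erase P (fun D => √(totalDegree d D : ℝ)) hC
  have h3 := Finset.add_sum_erase (P.erase C) (fun D => √(totalDegree d D : ℝ))
    (Finset.mem_erase.2 ⟨hne.symm, hC'⟩)
  have h4 : totalDegree d (C ∪ C') ≤ totalDegree d C + totalDegree d C' := by
    have := Finset.sum_union_inter (s₁ := C) (s₂ := C') (f := d)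
    unfold totalDegree
    omega
  have h5 : √(totalDegree d (C ∪ C') : ℝ) ≤ √(totalDegree d C' : ℝ) + √(totalDegree d C : ℝ) / 2 := by
    refine le_trans (Real.sqrt_le_sqrt ?_) (sqrt_add_le_sqrt_add_half_sqrt (Nat.cast_nonneg _)
      (Nat.cast_le.2 hle))
    exact_mod_cast h4
  unfold potential at *
  linarith

theorem sqrt_totalDegree_le_potential {P : Finset (Finset (Fin n))} {C : Finset (Fin n)}
    (hC : C ∈ P) : √(totalDegree d C) ≤ potential d P :=
  Finset.single_le_sum (f := fun D => √(totalDegree d D : ℝ)) (fun _ _ => Real.sqrt_nonneg _) hC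

/-- The gain of the first phase: a part `C` with all degrees at most `|C|` has total degree at most
`|C|²`. -/
theorem potential_le {G H : SimpleGraph (Fin n)} {P : Finset (Finset (Fin n))}
    (h : IsComponents G H P) (hP : ∀ C ∈ P, ∀ u ∈ C, d u ≤ C.card) : potential d P ≤ n := by
  have hn : (n : ℝ) = ∑ C ∈ P, (C.card : ℝ) := by exact_mod_cast h.sum_card.symm
  rw [hn]
  refine Finset.sum_le_sum fun C hC => ?_
  rw [Real.sqrt_le_left (Nat.cast_nonneg _)]
  have : totalDegree d C ≤ C.card * C.card := Finset.sum_le_card_nsmul _ _ _ (hP C hC)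
  rw [sq]
  exact_mod_cast this

/-! #### The decision trees -/

/-- Query the given positions until an answer outside of `C` is found. -/
def scan {I : Type} {Out : Type} (C : Finset (Fin n)) (m : ℕ)
    (found : I → Fin n → DecisionTree I (Fin n) Out) (fail : DecisionTree I (Fin n) Out) :
    List I → DecisionTree I (Fin n) Out
  | [] => fail
  | i :: l => .query i (fun a => decide (a ∈ C)) m (scan C m found fail l) (found i)

/-- At most one answer outside `C` is paid for, since the first one ends the scan. -/
theorem scan_spec {I : Type} {Out : Type} (C : Finset (Fin n)) (m : ℕ)
    (found : I → Fin n → DecisionTree I (Fin n) Out) (fail : DecisionTree I (Fin n) Out)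
    (x : I → Fin n) (l : List I) :
    ((∀ i ∈ l, x i ∈ C) ∧ (scan C m found fail l).eval x = fail.eval x ∧
      (scan C m found fail l).cost x = l.length * (1 / √(m + 1)) + fail.cost x) ∨
    ∃ i ∈ l, x i ∉ C ∧ (scan C m found fail l).eval x = (found i (x i)).eval x ∧
      (scan C m found fail l).cost x ≤
        l.length * (1 / √(m + 1)) + (√(m + 1) + 1) + (found i (x i)).cost x := by
  induction l with
  | nil => left; simp [scan]
  | cons i l ih =>
    have hpos : (0 : ℝ) ≤ 1 / √(m + 1) := by positivity
    by_cases hi : x i ∈ C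
    · rcases ih with ⟨h1, h2, h3⟩ | ⟨j, hj, h1, h2, h3⟩
      · left
        refine ⟨by simpa [hi] using h1, by simp [scan, DecisionTree.eval, hi, h2], ?_⟩
        simp only [scan, DecisionTree.cost, hi, decide_true, if_true, h3, List.length_cons]
        push_cast
        ring
      · right
        refine ⟨j, List.mem_cons_of_mem _ hj, h1, by simp [scan, DecisionTree.eval, hi, h2], ?_⟩
        simp only [scan, DecisionTree.cost, hi, decide_true, if_true, List.length_cons]
        push_cast
        linarith
    · right
      refine ⟨i, List.mem_cons_self, hi, by simp [scan, DecisionTree.eval, hi], ?_⟩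
      simp only [scan, DecisionTree.cost, hi, decide_false, Bool.false_eq_true, if_false,
        List.length_cons]
      push_cast
      have : (0 : ℝ) ≤ (l.length + 1) * (1 / √(m + 1)) := by positivity
      linarith

open Classical in
/-- A spanning tree of a connected graph. -/
noncomputable def treeOf (H : SimpleGraph (Fin n)) : Option (SimpleGraph (Fin n)) :=
  if h : H.Connected then some h.exists_isTree_le.choose else none

/-- Acyclicity of the found edges need not be tracked, as any spanning tree of `H` will do. -/
theorem spanningTreeAnswer_treeOf {G H : SimpleGraph (Fin n)} (hle : H ≤ G) (h : H.Connected) :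
    SpanningTreeAnswer G (treeOf H) := by
  rw [treeOf, dif_pos h]
  exact ⟨h.exists_isTree_le.choose_spec.1.trans hle, h.exists_isTree_le.choose_spec.2⟩

theorem exists_leastPart (d : Fin n → ℕ) {P : Finset (Finset (Fin n))} (hP : 1 < P.card) :
    ∃ C ∈ P, ∀ C' ∈ P, totalDegree d C ≤ totalDegree d C' :=
  Finset.exists_min_image P (totalDegree d) (Finset.card_pos.1 (by omega))

/-- Repeatedly look for an edge that leaves the part of least total degree. -/
noncomputable def mergeParts (d : Fin n → ℕ) : ℕ → Finset (Finset (Fin n)) → SimpleGraph (Fin n) →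
    DecisionTree (ArrayIndex n d) (Fin n) (Option (SimpleGraph (Fin n)))
  | 0, _, H => .ret (treeOf H)
  | k + 1, P, H =>
    if hP : 1 < P.card then
      let C := (exists_leastPart d hP).choose
      scan C (totalDegree d C)
        (fun i a => mergeParts d k (merge P C (partOf P a)) (H ⊔ SimpleGraph.edge i.1 a))
        (.ret none) (positions d C)
    else .ret (treeOf H)

theorem adj_of_ne {x : Arrays n d} {i : ArrayIndex n d} (hne : i.1 ≠ x i) :
    x.graph.Adj i.1 (x i) :=
  (SimpleGraph.fromRel_adj _ _ _).2 ⟨hne, Or.inl ⟨i.2, rfl⟩⟩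

/-- Amortized analysis: each successful scan is paid for by the drop of the potential, and a failed
scan, which ends the run, by the potential itself. -/
theorem mergeParts_spec [NeZero n] {x : Arrays n d} (hx : x.Symmetric) (k : ℕ)
    (P : Finset (Finset (Fin n))) (H : SimpleGraph (Fin n)) (h : IsComponents x.graph H P)
    (hk : P.card ≤ k + 1) :
    SpanningTreeAnswer x.graph ((mergeParts d k P H).eval x) ∧
      (mergeParts d k P H).cost x ≤ 8 * potential d P := by
  have hpot : ∀ P, 0 ≤ potential d P := fun P => Finset.sum_nonneg fun _ _ => Real.sqrt_nonneg _
  induction k generalizing P H with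
  | zero =>
    refine ⟨spanningTreeAnswer_treeOf h.le (h.connected hk), ?_⟩
    simpa [mergeParts, DecisionTree.cost] using hpot P
  | succ k ih =>
    rw [mergeParts]
    split_ifs with hP
    swap
    · refine ⟨spanningTreeAnswer_treeOf h.le (h.connected (by omega)), ?_⟩
      simpa [DecisionTree.cost] using hpot P
    obtain ⟨hC, hmin⟩ := (exists_leastPart d hP).choose_spec
    set C := (exists_leastPart d hP).choose
    simp only
    set m := totalDegree d C with hm
    have hm0 : (0 : ℝ) ≤ m := Nat.cast_nonneg _
    have hlen : ((positions d C).length : ℝ) * (1 / √(m + 1)) ≤ √m := by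
      rw [length_positions, ← hm, mul_one_div, div_le_iff₀ (by positivity)]
      calc (m : ℝ) = √m * √m := (Real.mul_self_sqrt hm0).symm
        _ ≤ √m * √(m + 1) := by gcongr; linarith
    have hmP : √(m : ℝ) ≤ potential d P := sqrt_totalDegree_le_potential hC
    rcases scan_spec C m (fun i a => mergeParts d k (merge P C (partOf P a))
      (H ⊔ SimpleGraph.edge i.1 a)) (.ret none) x (positions d C) with
      ⟨h1, h2, h3⟩ | ⟨⟨u, j⟩, hi, h1, h2, h3⟩
    · rw [h2, h3]
      constructor
      -- All rows of `C` have been read without leaving `C`; by symmetry of the arrays no edge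
      -- leaves it.
      · refine h.not_connected hC hP fun u hu v huv => ?_
        obtain ⟨j, hj⟩ : x.Edge u v := by
          rcases ((SimpleGraph.fromRel_adj _ _ _).1 huv).2 with h | h
          · exact h
          · exact hx _ _ h
        rw [← hj]
        exact h1 _ (mem_positions.2 hu)
      · simp only [DecisionTree.cost]
        linarith [hpot P]
    · have hu : u ∈ C := mem_positions.1 hi
      have ha := h.mem_partOf (x ⟨u, j⟩)
      have hC' := h.partOf_mem (x ⟨u, j⟩)
      have hne : C ≠ partOf P (x ⟨u, j⟩) := fun he => h1 (he ▸ ha)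
      have hua : u ≠ x ⟨u, j⟩ := fun he => h1 (he ▸ hu)
      obtain ⟨g1, g2⟩ := ih _ _ (h.merge hC hC' hu ha
        (adj_of_ne (i := ⟨u, j⟩) hua)) (by
        have := card_merge_lt hC hC' hne
        omega)
      refine ⟨h2 ▸ g1, h3.trans ?_⟩
      have g3 := potential_merge_le (d := d) hC hC' hne (hmin _ hC')
      rw [← hm] at g3
      have hm1 : (1 : ℝ) ≤ m := by
        have : 0 < m := by
          rw [hm, ← length_positions]
          exact List.length_pos_of_mem hi
        exact_mod_cast this
      -- The scan costs at most `√m + 3/2 √m + 1 ≤ 4 √m`, which is `8` times the drop `√m / 2`.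
      have h5 : 1 ≤ √(m : ℝ) := Real.one_le_sqrt.2 hm1
      have h6 : √((m : ℝ) + 1) ≤ 3 / 2 * √m := by
        rw [Real.sqrt_le_left (by positivity), mul_pow, Real.sq_sqrt hm0]
        linarith
      simp only at g2 ⊢
      linarith

/-- Query the remaining positions `l` of a vertex with current part `D`, absorbing unprocessed
vertices (those in `S`), until a processed part is met. -/
def absorbRow {d : Fin n → ℕ} {Out : Type}
    (next : Finset (Fin n) → Finset (Finset (Fin n)) → SimpleGraph (Fin n) →
      DecisionTree (ArrayIndex n d) (Fin n) Out) :
    List (ArrayIndex n d) → Finset (Fin n) → Finset (Fin n) → Finset (Finset (Fin n)) →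
      SimpleGraph (Fin n) → DecisionTree (ArrayIndex n d) (Fin n) Out
  | [], _, S, P, H => next S P H
  | i :: l, D, S, P, H => .query i (fun _ => false) 0 (next S P H) fun a =>
      if a ∈ D then absorbRow next l D S P H
      else if a ∈ S then absorbRow next l (D ∪ partOf P a) (S.erase a) (merge P D (partOf P a))
        (H ⊔ SimpleGraph.edge i.1 a)
      else next S (merge P D (partOf P a)) (H ⊔ SimpleGraph.edge i.1 a)

theorem exists_greatestDegree (d : Fin n → ℕ) {S : Finset (Fin n)} (hS : S.Nonempty) :
    ∃ v ∈ S, ∀ u ∈ S, d u ≤ d v :=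
  Finset.exists_max_image S d hS

/-- Absorb the neighbours of unprocessed vertices in the order of their degrees, and then merge. -/
noncomputable def search (d : Fin n → ℕ) : ℕ → Finset (Fin n) → Finset (Finset (Fin n)) →
    SimpleGraph (Fin n) → DecisionTree (ArrayIndex n d) (Fin n) (Option (SimpleGraph (Fin n)))
  | 0, _, P, H => mergeParts d n P H
  | t + 1, S, P, H =>
    if hS : S.Nonempty then
      let v := (exists_greatestDegree d hS).choose
      absorbRow (search d t) (positions d {v}) {v} (S.erase v) P H
    else mergeParts d n P H

/-- The part `C` is large in comparison to the degrees of its vertices and of those in `S`. -/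
def IsLarge (d : Fin n → ℕ) (S C : Finset (Fin n)) : Prop :=
  (∀ u ∈ C, d u ≤ C.card) ∧ ∀ u ∈ S, d u ≤ C.card

/-- The parts are the unprocessed vertices and large parts. -/
structure IsProgress (d : Fin n → ℕ) (S : Finset (Fin n)) (P : Finset (Finset (Fin n))) : Prop where
  singleton_mem : ∀ v ∈ S, {v} ∈ P
  isLarge : ∀ C ∈ P, (∃ v ∈ S, C = {v}) ∨ IsLarge d S C

theorem IsLarge.mono {S S' C : Finset (Fin n)} (h : IsLarge d S C) (hS : S' ⊆ S) :
    IsLarge d S' C :=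
  ⟨h.1, fun u hu => h.2 u (hS hu)⟩

/-- A row has no repetitions. This bounds `d v` by the size of the part once the row of `v` is
exhausted, and keeps the credit `|D| - |pre|` nonnegative. -/
theorem length_le_card {x : Arrays n d} (hx : x.NoMultipleEdges) {v : Fin n}
    {l : List (ArrayIndex n d)} (hl : l.Nodup) (hv : ∀ i ∈ l, i.1 = v) {D : Finset (Fin n)}
    (hD : ∀ i ∈ l, x i ∈ D) : l.length ≤ D.card := by
  rw [← List.toFinset_card_of_nodup hl]
  refine Finset.card_le_card_of_injOn x (fun i hi => hD i (by simpa using hi)) ?_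
  rintro ⟨a, j⟩ hi ⟨b, j'⟩ hi' he
  obtain rfl : a = v := hv _ (by simpa using hi)
  obtain rfl : b = a := hv _ (by simpa using hi')
  by_contra hne
  exact hx _ j j' (fun h => hne (by rw [h])) he

/-- Correctness and cost of `absorbRow`, relative to a postcondition `Q` on the answer and a bound
`B` on the remaining cost. -/
theorem absorbRow_spec {Out : Type} {x : Arrays n d} (hx : x.NoMultipleEdges)
    (next : Finset (Fin n) → Finset (Finset (Fin n)) → SimpleGraph (Fin n) →
      DecisionTree (ArrayIndex n d) (Fin n) Out) (Q : Out → Prop) (B : ℝ) (v : Fin n) (N : ℕ)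
    (hnext : ∀ S P H, S.card ≤ N → IsComponents x.graph H P → IsProgress d S P →
      Q ((next S P H).eval x) ∧ (next S P H).cost x ≤ 4 * S.card + B)
    (l pre : List (ArrayIndex n d)) (hl : pre ++ l = positions d {v})
    (D S : Finset (Fin n)) (P : Finset (Finset (Fin n))) (H : SimpleGraph (Fin n))
    (hpre : ∀ i ∈ pre, x i ∈ D) (h : IsComponents x.graph H P) (hN : S.card ≤ N) (hDP : D ∈ P)
    (hvD : v ∈ D) (hDv : ∀ u ∈ D, d u ≤ d v) (hSv : ∀ u ∈ S, d u ≤ d v) (hvS : v ∉ S)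
    (hSP : ∀ u ∈ S, {u} ∈ P)
    (hP : ∀ C ∈ P, C ≠ D → (∃ u ∈ S, C = {u}) ∨ IsLarge d (insert v S) C) :
    Q ((absorbRow next l D S P H).eval x) ∧ (absorbRow next l D S P H).cost x ≤
      4 * S.card + 2 * (D.card - pre.length) + 2 + B := by
  have hfst : ∀ i ∈ pre ++ l, i.1 = v := fun i hi => by
    rw [hl, mem_positions, Finset.mem_singleton] at hi
    exact hi
  have hnodup : (pre ++ l).Nodup := hl ▸ nodup_positions _
  have hlen : (pre.length : ℝ) ≤ D.card := by
    exact_mod_cast length_le_card hx hnodup.of_append_left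
      (fun i hi => hfst i (List.mem_append_left _ hi)) hpre
  induction l generalizing pre D S P H with
  | nil =>
    -- The row is exhausted, so `D` contains all `d v` neighbours; since `v` has the greatest degree
    -- around, `D` is large.
    have hd : d v ≤ D.card := by
      have h1 : pre.length = d v := by
        rw [← List.append_nil pre, hl, length_positions]
        simp [totalDegree]
      rw [← h1]
      exact_mod_cast hlen
    obtain ⟨h1, h2⟩ := hnext S P H hN h ⟨hSP, fun C hC => by
      by_cases hCD : C = D
      · subst hCD
        exact Or.inr ⟨fun u hu => (hDv u hu).trans hd, fun u hu => (hSv u hu).trans hd⟩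
      · exact (hP C hC hCD).imp_right fun hl => hl.mono (Finset.subset_insert _ _)⟩
    refine ⟨h1, ?_⟩
    simp only [absorbRow]
    linarith
  | cons i l ih =>
    have hi1 : i.1 = v := hfst i (by simp)
    subst hi1
    have hassoc : (pre ++ [i]) ++ l = positions d {i.1} := by simpa using hl
    -- With `m = 0` and no expected answers, a query costs `1 + 1 = 2`.
    have hsqrt : √(((0 : ℕ) : ℝ) + 1) = 1 := by simp
    have hfst' : ∀ q ∈ (pre ++ [i]) ++ l, q.1 = i.1 := fun q hq => hfst q (by simpa using hq)
    have hnodup' : ((pre ++ [i]) ++ l).Nodup := by simpa using hnodup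
    have hlen' : ∀ D' : Finset (Fin n), (∀ q ∈ pre ++ [i], x q ∈ D') →
        ((pre ++ [i]).length : ℝ) ≤ D'.card := fun D' hD' => by
      refine Nat.cast_le.2 (length_le_card hx (v := i.1) ?_ ?_ hD')
      · exact hnodup'.of_append_left
      · exact fun q hq => hfst' q (List.mem_append_left _ hq)
    simp only [absorbRow, DecisionTree.eval, DecisionTree.cost, Bool.false_eq_true, if_false, hsqrt]
    -- An answer inside `D` is paid for by the growth of `pre`, an absorbed vertex by the loss of
    -- one element of `S`, and the final merge by the constant `2`.
    by_cases haD : x i ∈ D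
    · have hpre' : ∀ q ∈ pre ++ [i], x q ∈ D := by
        intro q hi
        rcases List.mem_append.1 hi with hi | hi
        · exact hpre q hi
        · rw [List.mem_singleton.1 hi]; exact haD
      obtain ⟨h1, h2⟩ := ih (pre ++ [i]) hassoc D S P H hpre' h hN hDP hvD hDv hSv hvS hSP hP
        hfst' hnodup' (hlen' D hpre')
      simp only [haD, if_true]
      refine ⟨h1, ?_⟩
      simp only [List.length_append, List.length_singleton] at h2
      push_cast at h2
      linarith
    · have ha := h.mem_partOf (x i)
      have hC' := h.partOf_mem (x i)
      have hne : D ≠ partOf P (x i) := fun he => haD (he ▸ ha)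
      have hua : i.1 ≠ x i := fun he => haD (he ▸ hvD)
      have hmerge := h.merge hDP hC' hvD ha (adj_of_ne hua)
      have hmem : ∀ C ∈ merge P D (partOf P (x i)), C ≠ D ∪ partOf P (x i) →
          C ∈ P ∧ C ≠ D ∧ C ≠ partOf P (x i) := by
        intro C hC hC2
        simp only [merge, Finset.mem_insert, Finset.mem_erase] at hC
        tauto
      have hsingle : ∀ w ∈ S, w ≠ x i → {w} ∈ merge P D (partOf P (x i)) := by
        intro w hw hwa
        refine Finset.mem_insert_of_mem (Finset.mem_erase.2 ⟨fun he => hwa ?_,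
          Finset.mem_erase.2 ⟨fun he => hvS ?_, hSP w hw⟩⟩)
        · have := he ▸ ha
          exact (Finset.mem_singleton.1 this).symm
        · have := he ▸ hvD
          exact (Finset.mem_singleton.1 this) ▸ hw
      simp only [haD, if_false]
      by_cases haS : x i ∈ S
      · have hpart : partOf P (x i) = {x i} :=
          h.partOf_eq (hSP _ haS) (Finset.mem_singleton_self _)
        set a := x i with haeq
        have hpre' : ∀ q ∈ pre ++ [i], x q ∈ D ∪ partOf P a := by
          intro q hi
          rcases List.mem_append.1 hi with hi | hi
          · exact Finset.mem_union_left _ (hpre q hi)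
          · rw [List.mem_singleton.1 hi]; exact Finset.mem_union_right _ ha
        have hcard : (S.erase a).card + 1 = S.card := Finset.card_erase_add_one haS
        have hcardD : (D ∪ partOf P a).card = D.card + 1 := by
          rw [hpart, Finset.card_union_of_disjoint (Finset.disjoint_singleton_right.2 haD),
            Finset.card_singleton]
        obtain ⟨h1, h2⟩ := ih (pre ++ [i]) hassoc (D ∪ partOf P a) (S.erase a)
          (merge P D (partOf P a)) (H ⊔ SimpleGraph.edge i.1 a) hpre' hmerge (by omega)
          (Finset.mem_insert_self _ _) (Finset.mem_union_left _ hvD)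
          (fun w hw => by
            rcases Finset.mem_union.1 hw with hw | hw
            · exact hDv w hw
            · rw [hpart, Finset.mem_singleton] at hw
              exact hw ▸ hSv a haS)
          (fun w hw => hSv w (Finset.mem_of_mem_erase hw))
          (fun hu => hvS (Finset.mem_of_mem_erase hu))
          (fun w hw => hsingle w (Finset.mem_of_mem_erase hw) (Finset.ne_of_mem_erase hw))
          (fun C hC hCne => by
            obtain ⟨g1, g2, g3⟩ := hmem C hC hCne
            rcases hP C g1 g2 with ⟨w, hw, rfl⟩ | hlarge
            · refine Or.inl ⟨w, Finset.mem_erase.2 ⟨fun he => g3 ?_, hw⟩, rfl⟩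
              rw [hpart, he]
            · exact Or.inr (hlarge.mono (Finset.insert_subset_insert _ (Finset.erase_subset _ _))))
          hfst' hnodup' (hlen' _ hpre')
        simp only [haS, if_true]
        refine ⟨h1, ?_⟩
        have hcard' : ((S.erase a).card : ℝ) + 1 = S.card := by exact_mod_cast hcard
        simp only [List.length_append, List.length_singleton, hcardD] at h2
        push_cast at h2
        linarith
      -- The part that was met is neither `D` nor an unprocessed vertex, so it is large relative to
      -- `v` too. Its size bounds `d v` and thus all degrees in `D`, although the row of `v` is left
      -- unfinished.
      · have hlarge : IsLarge d (insert i.1 S) (partOf P (x i)) := by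
          rcases hP _ hC' hne.symm with ⟨w, hw, he⟩ | hlarge
          · rw [he, Finset.mem_singleton] at ha
            exact absurd (ha ▸ hw) haS
          · exact hlarge
        have hle : (partOf P (x i)).card ≤ (D ∪ partOf P (x i)).card :=
          Finset.card_le_card Finset.subset_union_right
        obtain ⟨h1, h2⟩ := hnext S _ _ hN hmerge
          ⟨fun w hw => hsingle w hw fun he => haS (he ▸ hw), fun C hC => by
            by_cases hCne : C = D ∪ partOf P (x i)
            · subst hCne
              refine Or.inr ⟨fun w hw => ?_, fun w hw =>
                (hlarge.2 w (Finset.mem_insert_of_mem hw)).trans hle⟩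
              rcases Finset.mem_union.1 hw with hw | hw
              · exact ((hDv w hw).trans (hlarge.2 _ (Finset.mem_insert_self _ _))).trans hle
              · exact (hlarge.1 w hw).trans hle
            · obtain ⟨g1, g2, _⟩ := hmem C hC hCne
              exact (hP C g1 g2).imp_right fun hl => hl.mono (Finset.subset_insert _ _)⟩
        simp only [haS, if_false]
        refine ⟨h1, ?_⟩
        linarith

theorem search_spec [NeZero n] {x : Arrays n d} (hx : x.NoMultipleEdges) (hx' : x.Symmetric)
    (t : ℕ) (S : Finset (Fin n)) (P : Finset (Finset (Fin n))) (H : SimpleGraph (Fin n))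
    (ht : S.card ≤ t) (h : IsComponents x.graph H P) (hP : IsProgress d S P) :
    SpanningTreeAnswer x.graph ((search d t S P H).eval x) ∧
      (search d t S P H).cost x ≤ 4 * S.card + 8 * n := by
  have hmerge : ∀ P H, IsComponents x.graph H P → IsProgress d ∅ P →
      SpanningTreeAnswer x.graph ((mergeParts d n P H).eval x) ∧
      (mergeParts d n P H).cost x ≤ 8 * n := by
    intro P H h hP
    have hcard : P.card ≤ n := by
      have h1 : P.card • 1 ≤ ∑ C ∈ P, C.card :=
        Finset.card_nsmul_le_sum _ _ _ fun C hC => Finset.card_pos.2 (h.nonempty C hC)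
      rw [h.sum_card] at h1
      simpa using h1
    obtain ⟨h1, h2⟩ := mergeParts_spec hx' n P H h (by omega)
    have h3 := potential_le (d := d) h fun C hC => by
      rcases hP.isLarge C hC with ⟨v, hv, _⟩ | hl
      · simp at hv
      · exact hl.1
    exact ⟨h1, by linarith⟩
  induction t generalizing S P H with
  | zero =>
    obtain rfl : S = ∅ := Finset.card_eq_zero.1 (by omega)
    simpa [search] using hmerge P H h hP
  | succ t ih =>
    rw [search]
    split_ifs with hS
    · obtain ⟨hv, hmax⟩ := (exists_greatestDegree d hS).choose_spec
      set v := (exists_greatestDegree d hS).choose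
      have hcard := Finset.card_erase_add_one hv
      have hcard' : ((S.erase v).card : ℝ) + 1 = S.card := by exact_mod_cast hcard
      -- Removing `v` from `S` releases `4`, which covers the initial `2 |{v}| + 2`.
      obtain ⟨h1, h2⟩ := absorbRow_spec hx (search d t) (SpanningTreeAnswer x.graph) (8 * n) v t
        ih (positions d {v}) [] rfl {v} (S.erase v) P H (by simp) h (by omega)
        (hP.singleton_mem v hv) (by simp) (by simp) (fun u hu => hmax u (Finset.mem_of_mem_erase hu))
        (by simp) (fun u hu => hP.singleton_mem u (Finset.mem_of_mem_erase hu)) (fun C hC hne => by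
          rw [Finset.insert_erase hv]
          refine (hP.isLarge C hC).imp_left ?_
          rintro ⟨u, hu, rfl⟩
          exact ⟨u, Finset.mem_erase.2 ⟨fun he => hne (by rw [he]), hu⟩, rfl⟩)
      refine ⟨h1, h2.trans ?_⟩
      simp only [Finset.card_singleton, List.length_nil]
      push_cast
      linarith
    · obtain rfl : S = ∅ := Finset.not_nonempty_iff_eq_empty.1 hS
      simpa using hmerge P H h hP

theorem exists_tree (n : ℕ) [NeZero n] (d : Fin n → ℕ) :
    ∃ tree : DecisionTree (ArrayIndex n d) (Fin n) (Option (SimpleGraph (Fin n))),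
      ∀ x ∈ Arrays.undirectedInputs n d,
        SpanningTreeAnswer x.graph (tree.eval x) ∧ tree.cost x ≤ 12 * n := by
  refine ⟨search d n Finset.univ (Finset.univ.image singleton) ⊥, fun x hx => ?_⟩
  obtain ⟨h1, h2⟩ := search_spec hx.1 hx.2 n Finset.univ (Finset.univ.image singleton) ⊥ (by simp)
    ⟨bot_le, by simp, by simp, by simp, by simp⟩ ⟨by simp, fun C hC => Or.inl (by simpa [eq_comm] using hC)⟩
  refine ⟨h1, h2.trans ?_⟩
  simp only [Finset.card_univ, Fintype.card_fin]
  linarith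

end SpanningTreeSearch

/-! ### Upper bounds -/

theorem quantumQueryComplexity_le {I A Out : Type} [Fintype I] [DecidableEq I] [Fintype A]
    [DecidableEq A] [AddGroup A] {promise : Set (I → A)} {accepted : (I → A) → Set Out} {T : ℕ}
    (h : ∃ alg : QueryAlgorithm I A Out T, alg.Solves promise accepted) :
    quantumQueryComplexity promise accepted ≤ T :=
  iInf₂_le T h

theorem exists_spanningTree_algorithm (n : ℕ) [NeZero n] (d : Fin n → ℕ) :
    ∃ alg : QueryAlgorithm (ArrayIndex n d) (Fin n) (Option (SimpleGraph (Fin n))) (144 * n),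
      alg.Solves (Arrays.undirectedInputs n d) fun f => {o | SpanningTreeAnswer (Arrays.graph f) o} := by
  obtain ⟨tree, h⟩ := SpanningTreeSearch.exists_tree n d
  -- The factor `12` from the conversion times the cost `12 n` of the tree.
  refine tree.exists_queryAlgorithm _ _ (Nat.mul_pos (by norm_num) (NeZero.pos n))
    (fun x hx => ?_) fun x hx => (h x hx).1
  push_cast
  linarith [(h x hx).2]

theorem spanningTreeComplexity_le (n : ℕ) [NeZero n] :
    spanningTreeComplexity n ≤ (144 : ℕ) * n := by
  refine iSup_le fun d => ?_
  have := quantumQueryComplexity_le (exists_spanningTree_algorithm n d)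
  exact_mod_cast this

theorem spanningTreeAnswer_isSome {V : Type} {G : SimpleGraph V} {o : Option (SimpleGraph V)}
    (h : SpanningTreeAnswer G o) : o.isSome = true ↔ G.Connected := by
  cases o with
  | none => simpa [SpanningTreeAnswer] using h
  | some S => simpa using h.2.connected.mono h.1

theorem solves_connectivity_of_spanningTree {n : ℕ} [NeZero n] {d : Fin n → ℕ} {T : ℕ}
    (h : ∃ alg : QueryAlgorithm (ArrayIndex n d) (Fin n) (Option (SimpleGraph (Fin n))) T,
      alg.Solves (Arrays.undirectedInputs n d) fun f => {o | SpanningTreeAnswer (Arrays.graph f) o}) :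
    ∃ alg : QueryAlgorithm (ArrayIndex n d) (Fin n) Bool T,
      alg.Solves (Arrays.undirectedInputs n d) fun f => {b | b = true ↔ (Arrays.graph f).Connected} := by
  obtain ⟨alg, h⟩ := h
  exact ⟨alg.mapOutput Option.isSome,
    h.mapOutput Option.isSome fun _ _ _ ho => spanningTreeAnswer_isSome ho⟩

theorem connectivityComplexity_le (n : ℕ) [NeZero n] :
    connectivityComplexity n ≤ (144 : ℕ) * n := by
  refine iSup_le fun d => ?_
  have := quantumQueryComplexity_le
    (solves_connectivity_of_spanningTree (exists_spanningTree_algorithm n d))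
  exact_mod_cast this

/-! ### The polynomial method -/

/-- The functions of `p` bits that are linear combinations of functions of at most `k` bits. -/
def lowDegree (p k : ℕ) : Submodule ℂ ((Fin p → Bool) → ℂ) :=
  Submodule.span ℂ {g | ∃ S : Finset (Fin p), S.card ≤ k ∧
    ∀ x y, (∀ i ∈ S, x i = y i) → g x = g y}

theorem mem_lowDegree_of_forall {p k : ℕ} {g : (Fin p → Bool) → ℂ} (S : Finset (Fin p))
    (hS : S.card ≤ k) (h : ∀ x y, (∀ i ∈ S, x i = y i) → g x = g y) : g ∈ lowDegree p k :=
  Submodule.subset_span ⟨S, hS, h⟩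

theorem mul_mem_lowDegree {p k l : ℕ} {f g : (Fin p → Bool) → ℂ} (hf : f ∈ lowDegree p k)
    (hg : g ∈ lowDegree p l) : f * g ∈ lowDegree p (k + l) := by
  have h : lowDegree p k * lowDegree p l ≤ lowDegree p (k + l) := by
    rw [lowDegree, lowDegree, Submodule.span_mul_span, Submodule.span_le]
    rintro _ ⟨f, ⟨S, hS, hf⟩, g, ⟨S', hS', hg⟩, rfl⟩
    refine mem_lowDegree_of_forall (S ∪ S') ((Finset.card_union_le _ _).trans (by omega)) ?_
    intro x y hxy
    simp only [Pi.mul_apply]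
    rw [hf x y fun i hi => hxy i (Finset.mem_union_left _ hi),
      hg x y fun i hi => hxy i (Finset.mem_union_right _ hi)]
  exact h (Submodule.mul_mem_mul hf hg)

theorem star_mem_lowDegree {p k : ℕ} {f : (Fin p → Bool) → ℂ} (hf : f ∈ lowDegree p k) :
    star f ∈ lowDegree p k := by
  induction hf using Submodule.span_induction with
  | mem f hf =>
    obtain ⟨S, hS, hf⟩ := hf
    refine mem_lowDegree_of_forall S hS fun x y hxy => ?_
    rw [Pi.star_apply, Pi.star_apply, hf x y hxy]
  | zero => rw [star_zero]; exact zero_mem _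
  | add f g _ _ hf hg => rw [star_add]; exact add_mem hf hg
  | smul c f _ hf => rw [star_smul]; exact Submodule.smul_mem _ _ hf

/-- The parity character. -/
def paritySign {p : ℕ} (x : Fin p → Bool) : ℝ := ∏ i, if x i then -1 else 1

theorem paritySign_update {p : ℕ} (x : Fin p → Bool) (i : Fin p) :
    paritySign (Function.update x i (!x i)) = -paritySign x := by
  unfold paritySign
  rw [← Finset.mul_prod_erase _ _ (Finset.mem_univ i), ← Finset.mul_prod_erase Finset.univ
    (fun j => if x j then (-1 : ℝ) else 1) (Finset.mem_univ i)]
  have : ∏ j ∈ Finset.univ.erase i, (if Function.update x i (!x i) j then (-1 : ℝ) else 1) =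
      ∏ j ∈ Finset.univ.erase i, if x j then (-1 : ℝ) else 1 :=
    Finset.prod_congr rfl fun j hj => by
      rw [Function.update_of_ne (Finset.ne_of_mem_erase hj)]
  rw [this]
  cases x i <;> simp

theorem paritySign_eq_or {p : ℕ} (x : Fin p → Bool) : paritySign x = 1 ∨ paritySign x = -1 := by
  unfold paritySign
  induction (Finset.univ : Finset (Fin p)) using Finset.induction_on with
  | empty => simp
  | insert i s hi ih =>
    rw [Finset.prod_insert hi]
    rcases ih with h | h <;> rw [h] <;> split_ifs <;> norm_num

/-- Flipping a bit on which the function does not depend changes only the sign of the parity, so the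
terms cancel in pairs. -/
theorem sum_paritySign_mul_eq_zero {p k : ℕ} (hk : k < p) {g : (Fin p → Bool) → ℂ}
    (hg : g ∈ lowDegree p k) : ∑ x, (paritySign x : ℂ) * g x = 0 := by
  induction hg using Submodule.span_induction with
  | mem g hg =>
    obtain ⟨S, hS, hg⟩ := hg
    obtain ⟨i, hi⟩ : ∃ i, i ∉ S := by
      by_contra! h
      have : S = Finset.univ := Finset.eq_univ_iff_forall.2 h
      rw [this, Finset.card_univ, Fintype.card_fin] at hS
      omega
    have hinv : Function.Involutive fun x : Fin p → Bool => Function.update x i (!x i) :=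
      fun x => by simp
    have h1 := Equiv.sum_comp (hinv.toPerm _) fun x : Fin p → Bool => (paritySign x : ℂ) * g x
    have h2 : ∀ x, (paritySign (hinv.toPerm _ x) : ℂ) * g (hinv.toPerm _ x) =
        -((paritySign x : ℂ) * g x) := by
      intro x
      change (paritySign (Function.update x i (!x i)) : ℂ) * g (Function.update x i (!x i)) = _
      rw [paritySign_update, hg (Function.update x i (!x i)) x fun j hj =>
        Function.update_of_ne (show j ≠ i by rintro rfl; exact hi hj) _ _]
      push_cast
      ring
    rw [Finset.sum_congr rfl fun x _ => h2 x, Finset.sum_neg_distrib] at h1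
    exact self_eq_neg.1 h1.symm
  | zero => simp
  | add f g _ _ hf hg => simp only [Pi.add_apply, mul_add, Finset.sum_add_distrib, hf, hg, add_zero]
  | smul c f _ hf =>
    have : ∀ x, (paritySign x : ℂ) * (c • f) x = c * ((paritySign x : ℂ) * f x) := fun x => by
      rw [Pi.smul_apply, smul_eq_mul]; ring
    simp only [this, ← Finset.mul_sum, hf, mul_zero]

section PolynomialMethod

variable {I A Out : Type} [Fintype I] [DecidableEq I] [Fintype A] [DecidableEq A] [AddGroup A]
  {T p : ℕ}

theorem state_mem_lowDegree (alg : QueryAlgorithm I A Out T) {F : (Fin p → Bool) → I → A}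
    (hF : ∀ i, ∃ j, ∀ x y, x j = y j → F x i = F y i) (t : ℕ) (b : Option I × A × alg.Work) :
    (fun x => alg.state (F x) t b) ∈ lowDegree p t := by
  induction t generalizing b with
  | zero => exact mem_lowDegree_of_forall ∅ (by simp) fun x y _ => rfl
  | succ t ih =>
    have horacle : ∀ b', (fun x => queryOracle (F x) (alg.state (F x) t) b') ∈
        lowDegree p (t + 1) := by
      rintro ⟨_ | i, a, w⟩
      · have h1 : (1 : (Fin p → Bool) → ℂ) ∈ lowDegree p 1 :=
          mem_lowDegree_of_forall ∅ (by simp) fun x y _ => rfl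
        have := mul_mem_lowDegree (ih (none, a, w)) h1
        rwa [mul_one] at this
      · obtain ⟨j, hj⟩ := hF i
        -- The amplitude is split by the value `c` of the queried entry; the indicator of `F x i =
        -- c` depends on one bit, so a query raises the degree by at most one.
        have : (fun x => queryOracle (F x) (alg.state (F x) t) (some i, a, w)) =
            ∑ c, (fun x => alg.state (F x) t (some i, a - c, w)) *
              fun x => if F x i = c then (1 : ℂ) else 0 := by
          funext x
          rw [Finset.sum_apply, Finset.sum_eq_single (F x i)]
          · simp [queryOracle]
          · intro c _ hc
            simp [hc.symm]
          · simp
        rw [this]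
        refine Submodule.sum_mem _ fun c _ => mul_mem_lowDegree (ih _) ?_
        refine mem_lowDegree_of_forall {j} (by simp) fun x y hxy => ?_
        rw [hj x y (hxy j (Finset.mem_singleton_self _))]
    have : (fun x => alg.state (F x) (t + 1) b) =
        ∑ b', (alg.U (t + 1)).1 b b' • fun x => queryOracle (F x) (alg.state (F x) t) b' := by
      funext x
      rw [Finset.sum_apply]
      rfl
    rw [this]
    exact Submodule.sum_mem _ fun b' _ => Submodule.smul_mem _ _ (horacle b')

theorem prob_mem_lowDegree (alg : QueryAlgorithm I A Out T) {F : (Fin p → Bool) → I → A}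
    (hF : ∀ i, ∃ j, ∀ x y, x j = y j → F x i = F y i) (S : Set Out) :
    (fun x => (alg.prob (F x) S : ℂ)) ∈ lowDegree p (T + T) := by
  classical
  have : (fun x => (alg.prob (F x) S : ℂ)) = ∑ b, if alg.output b ∈ S then
      star (fun x => alg.state (F x) T b) * (fun x => alg.state (F x) T b) else 0 := by
    funext x
    rw [QueryAlgorithm.prob, Finset.sum_apply, Complex.ofReal_sum]
    refine Finset.sum_congr rfl fun b _ => ?_
    split_ifs
    · simp [RCLike.conj_mul]
    · simp
  rw [this]
  refine Submodule.sum_mem _ fun b _ => ?_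
  split_ifs
  · exact mul_mem_lowDegree (star_mem_lowDegree (state_mem_lowDegree alg hF T b))
      (state_mem_lowDegree alg hF T b)
  · exact zero_mem _

/-- An algorithm deciding a property to which parity reduces locally makes at least `p / 2`
queries. -/
theorem le_two_mul_of_solves_parity {alg : QueryAlgorithm I A Bool T} {promise : Set (I → A)}
    {Q : (I → A) → Prop} (h : alg.Solves promise fun f => {b | b = true ↔ Q f})
    {F : (Fin p → Bool) → I → A} (hF : ∀ i, ∃ j, ∀ x y, x j = y j → F x i = F y i)
    (hpromise : ∀ x, F x ∈ promise) (hQ : ∀ x, Q (F x) ↔ paritySign x = 1) : p ≤ 2 * T := by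
  by_contra! hp
  have h1 := sum_paritySign_mul_eq_zero (by omega) (prob_mem_lowDegree alg hF {true})
  have h2 := sum_paritySign_mul_eq_zero (k := 0) (p := p) (g := 1) (by omega)
    (mem_lowDegree_of_forall ∅ (by simp) fun x y _ => rfl)
  have h3 : ∑ x, paritySign x * (alg.prob (F x) {true} - 1 / 2) = 0 := by
    have : ∀ x, paritySign x * (alg.prob (F x) {true} - 1 / 2) =
        paritySign x * alg.prob (F x) {true} - 1 / 2 * (paritySign x * 1) := fun x => by ring
    simp only [this, Finset.sum_sub_distrib, ← Finset.mul_sum]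
    simp only [Pi.one_apply] at h2
    have h1' : ∑ x, paritySign x * alg.prob (F x) {true} = 0 := by exact_mod_cast h1
    have h2' : ∑ x : Fin p → Bool, paritySign x * 1 = 0 := by exact_mod_cast h2
    rw [h1', h2']
    ring
  -- Every term is positive: the acceptance probability is at least `2/3` for even parity and at
  -- most `1/3` for odd.
  have h4 : 0 < ∑ x, paritySign x * (alg.prob (F x) {true} - 1 / 2) := by
    refine Finset.sum_pos (fun x _ => ?_) Finset.univ_nonempty
    have hx := h (F x) (hpromise x)
    simp only [hQ] at hx
    rcases paritySign_eq_or x with hs | hs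
    · have : {b : Bool | b = true ↔ paritySign x = 1} = {true} := by ext b; simp [hs]
      rw [this] at hx
      rw [hs]
      linarith
    · have : {b : Bool | b = true ↔ paritySign x = 1} = {true}ᶜ := by
        ext b
        simp [hs]
        norm_num
      rw [this] at hx
      have := alg.prob_add_prob_compl (F x) {true}
      rw [hs]
      linarith
  exact h4.ne' h3

end PolynomialMethod

/-! ### Twisted ladders -/

namespace Ladder

/-- The bits of `x`, extended by `false`. -/
def bit {p : ℕ} (x : Fin p → Bool) (k : ℕ) : Bool := if h : k < p then x ⟨k, h⟩ else false

/-- Exchange the two ends `0` and `1` of a rung if `b` holds. -/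
def flip (b : Bool) (r : ℕ) : ℕ := if b then 1 - r else r

/-- The parity of the first `q` bits. -/
def parity {p : ℕ} (x : Fin p → Bool) : ℕ → Bool
  | 0 => false
  | q + 1 => xor (parity x q) (bit x q)

theorem flip_lt {b : Bool} {r : ℕ} (hr : r < 2) : flip b r < 2 := by
  unfold flip; split_ifs <;> omega

theorem flip_flip_self {b : Bool} {r : ℕ} (hr : r < 2) : flip b (flip b r) = r := by
  unfold flip; split_ifs <;> omega

theorem flip_flip {b c : Bool} {r : ℕ} (hr : r < 2) : flip b (flip c r) = flip (xor b c) r := by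
  cases b <;> cases c <;> simp [flip]
  omega

theorem paritySign_eq_one_iff {p : ℕ} (x : Fin p → Bool) :
    paritySign x = 1 ↔ parity x p = false := by
  have h : ∀ q, ∏ k ∈ Finset.range q, (if bit x k then (-1 : ℝ) else 1) =
      if parity x q then -1 else 1 := by
    intro q
    induction q with
    | zero => simp [parity]
    | succ q ih =>
      rw [Finset.prod_range_succ, ih, parity]
      cases parity x q <;> cases bit x q <;> simp
  have h2 : paritySign x = ∏ k ∈ Finset.range p, (if bit x k then (-1 : ℝ) else 1) := by
    rw [← Fin.prod_univ_eq_prod_range, paritySign]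
    exact Finset.prod_congr rfl fun i _ => by simp [bit]
  rw [h2, h]
  cases parity x p <;> simp
  norm_num

theorem exists_bit_local {p : ℕ} (hp : 0 < p) (k : ℕ) :
    ∃ j : Fin p, ∀ x y : Fin p → Bool, x j = y j → bit x k = bit y k := by
  by_cases h : k < p
  · exact ⟨⟨k, h⟩, fun x y hxy => by simpa [bit, h] using hxy⟩
  · exact ⟨⟨0, hp⟩, fun x y _ => by simp [bit, h]⟩

/-- The next vertex on the ladder, whose rung `q` consists of `2 q` and `2 q + 1`, for `q ≤ p`, and
whose vertex `2 p + 1` is joined to `0` by a path through the vertices from `2 p + 2` on.  The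
vertices `1` and `2 p` have loops. -/
def succ (n : ℕ) {p : ℕ} (x : Fin p → Bool) (v : ℕ) : ℕ :=
  if v < 2 * p then 2 * (v / 2 + 1) + flip (bit x (v / 2)) (v % 2)
  else if v = 2 * p then 2 * p else if v + 1 = n then 0 else v + 1

/-- The preceding vertex on the ladder. -/
def pred (n : ℕ) {p : ℕ} (x : Fin p → Bool) (v : ℕ) : ℕ :=
  if v = 0 then n - 1 else if v = 1 then 1
  else if v < 2 * p + 2 then 2 * (v / 2 - 1) + flip (bit x (v / 2 - 1)) (v % 2) else v - 1

variable {n p : ℕ} {x : Fin p → Bool}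

theorem succ_rung {q r : ℕ} (hq : q < p) (hr : r < 2) :
    succ n x (2 * q + r) = 2 * (q + 1) + flip (bit x q) r := by
  have h1 : (2 * q + r) / 2 = q := by omega
  have h2 : (2 * q + r) % 2 = r := by omega
  rw [succ, if_pos (by omega), h1, h2]

theorem pred_rung {q r : ℕ} (hq : q < p) (hr : r < 2) :
    pred n x (2 * (q + 1) + r) = 2 * q + flip (bit x q) r := by
  have h1 : (2 * (q + 1) + r) / 2 - 1 = q := by omega
  have h2 : (2 * (q + 1) + r) % 2 = r := by omega
  rw [pred, if_neg (by omega), if_neg (by omega), if_pos (by omega), h1, h2]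

theorem succ_lt (hn : 2 * p + 2 ≤ n) {v : ℕ} (hv : v < n) : succ n x v < n := by
  have := flip_lt (b := bit x (v / 2)) (r := v % 2) (by omega)
  unfold succ
  split_ifs <;> omega

theorem pred_lt (hn : 2 * p + 2 ≤ n) {v : ℕ} (hv : v < n) : pred n x v < n := by
  have := flip_lt (b := bit x (v / 2 - 1)) (r := v % 2) (by omega)
  unfold pred
  split_ifs <;> omega

/-- For `p = 1` and `n = 4` both neighbours of `0` can be `3`; hence `2 ≤ p`. -/
theorem succ_ne_pred (hp : 2 ≤ p) (hn : 2 * p + 2 ≤ n) {v : ℕ} (hv : v < n) :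
    succ n x v ≠ pred n x v := by
  have := flip_lt (b := bit x (v / 2 - 1)) (r := v % 2) (by omega)
  have := flip_lt (b := bit x (v / 2)) (r := v % 2) (by omega)
  unfold succ pred
  split_ifs <;> omega

theorem symm_succ {v : ℕ} (hv : v < n) :
    succ n x (succ n x v) = v ∨ pred n x (succ n x v) = v := by
  by_cases h : v < 2 * p
  · right
    obtain ⟨q, r, hr, rfl⟩ : ∃ q r, r < 2 ∧ v = 2 * q + r := ⟨v / 2, v % 2, by omega, by omega⟩
    rw [succ_rung (by omega) hr, pred_rung (by omega) (flip_lt hr), flip_flip_self hr]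
  · by_cases h1 : v = 2 * p
    · left
      simp [succ, h1]
    · right
      by_cases h2 : v + 1 = n
      · simp [succ, h, h1, h2, pred]
        omega
      · have : succ n x v = v + 1 := by simp [succ, h, h1, h2]
        rw [this, pred, if_neg (by omega), if_neg (by omega), if_neg (by omega)]
        omega

theorem symm_pred (hn : 2 * p + 2 ≤ n) {v : ℕ} (hv : v < n) :
    succ n x (pred n x v) = v ∨ pred n x (pred n x v) = v := by
  by_cases h0 : v = 0
  · left
    have : pred n x v = n - 1 := by simp [pred, h0]
    rw [this, succ, if_neg (by omega), if_neg (by omega), if_pos (by omega), h0]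
  by_cases h1 : v = 1
  · right
    simp [pred, h1]
  left
  by_cases h2 : v < 2 * p + 2
  · obtain ⟨q, r, hr, rfl⟩ : ∃ q r, r < 2 ∧ v = 2 * (q + 1) + r :=
      ⟨v / 2 - 1, v % 2, by omega, by omega⟩
    rw [pred_rung (by omega) hr, succ_rung (by omega) (flip_lt hr), flip_flip_self hr]
  · have : pred n x v = v - 1 := by simp [pred, h0, h1, h2]
    rw [this, succ, if_neg (by omega), if_neg (by omega), if_neg (by omega)]
    omega

/-- The component of a vertex, if the parity of all bits is odd. -/
def color {p : ℕ} (x : Fin p → Bool) (v : ℕ) : ℕ :=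
  if v < 2 * p + 2 then flip (parity x (v / 2)) (v % 2) else 0

theorem color_rung {q r : ℕ} (hq : q ≤ p) (hr : r < 2) :
    color x (2 * q + r) = flip (parity x q) r := by
  have h1 : (2 * q + r) / 2 = q := by omega
  have h2 : (2 * q + r) % 2 = r := by omega
  rw [color, if_pos (by omega), h1, h2]

theorem color_last (hx : parity x p = true) {v : ℕ} (hv : 2 * p < v) : color x v = 0 := by
  by_cases h : v < 2 * p + 2
  · obtain rfl : v = 2 * p + 1 := by omega
    rw [color_rung le_rfl (by omega), hx]
    rfl
  · simp [color, h]

theorem color_zero : color x 0 = 0 := by simp [color, parity, flip]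

/-- The color of a rung vertex is the end of rung `0` at which its strand starts. For odd parity the
strand from `0` ends in `2 p + 1`, so the returning path closes it into a cycle that avoids the
strand from `1`. -/
theorem color_succ (hx : parity x p = true) {v : ℕ} :
    color x (succ n x v) = color x v := by
  by_cases h : v < 2 * p
  · obtain ⟨q, r, hr, rfl⟩ : ∃ q r, r < 2 ∧ v = 2 * q + r := ⟨v / 2, v % 2, by omega, by omega⟩
    rw [succ_rung (by omega) hr, color_rung (by omega) (flip_lt hr), color_rung (by omega) hr,
      parity, flip_flip hr]
    simp
  · by_cases h1 : v = 2 * p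
    · simp [succ, h1]
    · rw [color_last hx (v := v) (by omega), succ, if_neg h, if_neg h1]
      split_ifs
      · exact color_zero
      · exact color_last hx (by omega)

theorem color_pred (hn : 2 * p + 2 ≤ n) (hx : parity x p = true) {v : ℕ} (hv : v < n) :
    color x (pred n x v) = color x v := by
  by_cases h1 : v = 1
  · simp [pred, h1]
  · rcases symm_pred (x := x) hn hv with h | h
    · rw [← color_succ (n := n) hx (v := pred n x v), h]
    · by_cases h0 : v = 0
      · have : pred n x v = n - 1 := by simp [pred, h0]
        rw [this, color_last hx (by omega), h0, color_zero]
      · by_cases h2 : v < 2 * p + 2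
        · obtain ⟨q, r, hr, rfl⟩ : ∃ q r, r < 2 ∧ v = 2 * (q + 1) + r :=
            ⟨v / 2 - 1, v % 2, by omega, by omega⟩
          rw [pred_rung (by omega) hr, color_rung (by omega) (flip_lt hr),
            color_rung (by omega) hr, parity, flip_flip hr]
        · have : pred n x v = v - 1 := by simp [pred, h0, h1, h2]
          rw [this, color_last hx (by omega), color_last hx (by omega)]

/-- The arrays of the ladder. -/
def arrays (hn : 2 * p + 2 ≤ n) (x : Fin p → Bool) : Arrays n fun _ => 2 := fun i =>
  if i.2.1 = 0 then ⟨succ n x i.1, succ_lt hn i.1.2⟩ else ⟨pred n x i.1, pred_lt hn i.1.2⟩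

theorem edge_iff (hn : 2 * p + 2 ≤ n) (u v : Fin n) :
    (arrays hn x).Edge u v ↔ (v : ℕ) = succ n x u ∨ (v : ℕ) = pred n x u := by
  constructor
  · rintro ⟨j, rfl⟩
    fin_cases j
    · exact Or.inl rfl
    · exact Or.inr rfl
  · rintro (h | h)
    · exact ⟨0, Fin.ext h.symm⟩
    · exact ⟨1, Fin.ext h.symm⟩

theorem arrays_mem (hp : 2 ≤ p) (hn : 2 * p + 2 ≤ n) :
    arrays hn x ∈ Arrays.undirectedInputs n fun _ => 2 := by
  constructor
  · intro i j j' hne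
    have h := succ_ne_pred (x := x) hp hn i.2
    fin_cases j <;> fin_cases j' <;> simp_all [arrays, eq_comm]
  · intro u v h
    rw [edge_iff] at h ⊢
    rcases h with h | h <;> rw [h]
    · exact (symm_succ u.2).imp Eq.symm Eq.symm
    · exact (symm_pred hn u.2).imp Eq.symm Eq.symm

theorem arrays_local (hp : 0 < p) (hn : 2 * p + 2 ≤ n) (i : ArrayIndex n fun _ => 2) :
    ∃ j, ∀ x y : Fin p → Bool, x j = y j → arrays hn x i = arrays hn y i := by
  by_cases h : i.2.1 = 0
  · obtain ⟨j, hj⟩ := exists_bit_local hp (i.1 / 2)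
    refine ⟨j, fun x y hxy => ?_⟩
    simp only [arrays, h, if_true, succ, hj x y hxy]
  · obtain ⟨j, hj⟩ := exists_bit_local hp (i.1 / 2 - 1)
    refine ⟨j, fun x y hxy => ?_⟩
    simp only [arrays, h, if_false, pred, hj x y hxy]

theorem not_connected (hn : 2 * p + 2 ≤ n) (hx : parity x p = true) :
    ¬ (arrays hn x).graph.Connected := by
  intro h
  have hedge : ∀ u v, (arrays hn x).Edge u v → color x u = color x v := by
    intro u v huv
    rcases (edge_iff hn u v).1 huv with h | h <;> rw [h]
    · exact (color_succ hx).symm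
    · exact (color_pred hn hx u.2).symm
  have key : ∀ u v, (arrays hn x).graph.Walk u v → color x u = color x v := by
    intro u v w
    induction w with
    | nil => rfl
    | cons hadj _ ih =>
      rw [← ih]
      rcases ((SimpleGraph.fromRel_adj _ _ _).1 hadj).2 with h | h
      · exact hedge _ _ h
      · exact (hedge _ _ h).symm
  obtain ⟨w⟩ := h.preconnected ⟨0, by omega⟩ ⟨1, by omega⟩
  have := key _ _ w
  simp [color, parity, flip] at this

theorem connected (hn : 2 * p + 2 ≤ n) (hx : parity x p = false) :
    (arrays hn x).graph.Connected := by
  set G := (arrays hn x).graph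
  have hedge : ∀ u v : Fin n, (arrays hn x).Edge u v → G.Reachable u v := by
    intro u v h
    by_cases huv : u = v
    · rw [huv]
    · exact ((SimpleGraph.fromRel_adj _ _ _).2 ⟨huv, Or.inl h⟩).reachable
  have hrung : ∀ q r (hq : q ≤ p) (hr : r < 2),
      G.Reachable ⟨2 * q + r, by omega⟩ ⟨flip (parity x q) r, lt_of_lt_of_le (flip_lt hr) (by omega)⟩ := by
    intro q
    induction q with
    | zero =>
      intro r _ hr
      simp only [parity, flip, mul_zero, zero_add]
      exact SimpleGraph.Reachable.refl _
    | succ q ih =>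
      intro r hq hr
      have h1 : G.Reachable ⟨2 * (q + 1) + r, by omega⟩
          ⟨2 * q + flip (bit x q) r, by have := flip_lt (b := bit x q) hr; omega⟩ :=
        hedge _ _ ((edge_iff hn _ _).2 (Or.inr (pred_rung (by omega) hr).symm))
      refine h1.trans ?_
      have h2 := ih (flip (bit x q) r) (by omega) (flip_lt hr)
      simp only [flip_flip hr] at h2
      exact h2
  have hpath : ∀ k (hk : 2 * p + 1 + k < n),
      G.Reachable ⟨2 * p + 1, by omega⟩ ⟨2 * p + 1 + k, hk⟩ := by
    intro k
    induction k with
    | zero => exact fun _ => SimpleGraph.Reachable.refl _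
    | succ k ih =>
      intro hk
      refine (ih (by omega)).trans (hedge _ _ ((edge_iff hn _ _).2 (Or.inl ?_)))
      simp only [succ]
      rw [if_neg (by omega), if_neg (by omega), if_neg (by omega)]
      rfl
  -- For even parity the strand through `2 p + 1` starts in `1`, so the returning path to `0` links
  -- the two strands.
  have hone : G.Reachable ⟨2 * p + 1, by omega⟩ ⟨1, by omega⟩ := by
    have := hrung p 1 le_rfl (by omega)
    simpa only [hx, flip, Bool.false_eq_true, if_false] using this
  have hzero : G.Reachable ⟨2 * p + 1, by omega⟩ ⟨0, by omega⟩ := by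
    refine (hpath (n - 1 - (2 * p + 1)) (by omega)).trans
      (hedge _ _ ((edge_iff hn _ _).2 (Or.inl ?_)))
    simp only [succ]
    rw [if_neg (by omega), if_neg (by omega), if_pos (by omega)]
  have hall : ∀ v : Fin n, G.Reachable ⟨2 * p + 1, by omega⟩ v := by
    rintro ⟨v, hv⟩
    by_cases h : v < 2 * p + 2
    · have h1 := hrung (v / 2) (v % 2) (by omega) (by omega)
      have h2 : 2 * (v / 2) + v % 2 = v := by omega
      simp only [h2] at h1
      refine SimpleGraph.Reachable.trans ?_ h1.symm
      have h3 := flip_lt (b := parity x (v / 2)) (r := v % 2) (by omega)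
      have h4 : flip (parity x (v / 2)) (v % 2) = 0 ∨ flip (parity x (v / 2)) (v % 2) = 1 := by
        omega
      rcases h4 with h4 | h4 <;> simp only [h4]
      · exact hzero
      · exact hone
    · have := hpath (v - (2 * p + 1)) (by omega)
      simpa only [show 2 * p + 1 + (v - (2 * p + 1)) = v by omega] using this
  have : Nonempty (Fin n) := ⟨⟨0, by omega⟩⟩
  exact (SimpleGraph.connected_iff _).2 ⟨fun u v => (hall u).symm.trans (hall v), this⟩

theorem connected_iff (hn : 2 * p + 2 ≤ n) (x : Fin p → Bool) :
    (arrays hn x).graph.Connected ↔ paritySign x = 1 := by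
  rw [paritySign_eq_one_iff]
  cases h : parity x p
  · simpa using connected hn h
  · simpa using not_connected hn h

end Ladder

/-! ### Lower bounds -/

/-- With `p = (n - 2) / 2 ≥ 2` the parity bound gives `n ≤ 2 p + 3 ≤ 4 T + 3` and `T ≥ 1`. -/
theorem le_eight_mul_of_solves_connectivity {n T : ℕ} [NeZero n] (hn : 6 ≤ n)
    {alg : QueryAlgorithm (ArrayIndex n fun _ => 2) (Fin n) Bool T}
    (h : alg.Solves (Arrays.undirectedInputs n fun _ => 2)
      fun f => {b | b = true ↔ (Arrays.graph f).Connected}) : n ≤ 8 * T := by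
  have hp : 2 * ((n - 2) / 2) + 2 ≤ n := by omega
  have := le_two_mul_of_solves_parity h (Ladder.arrays_local (by omega) hp)
    (fun x => Ladder.arrays_mem (by omega) hp) (Ladder.connected_iff hp)
  omega

theorem le_eight_mul_quantumQueryComplexity {I A Out : Type} [Fintype I] [DecidableEq I]
    [Fintype A] [DecidableEq A] [AddGroup A] {promise : Set (I → A)}
    {accepted : (I → A) → Set Out} {n : ℕ}
    (h : ∀ T, (∃ alg : QueryAlgorithm I A Out T, alg.Solves promise accepted) → n ≤ 8 * T) :
    (n : ℕ∞) ≤ (8 : ℕ) * quantumQueryComplexity promise accepted := by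
  -- The ceiling of `n / 8`, which avoids division in `ℕ∞`.
  have h1 : (((n + 7) / 8 : ℕ) : ℕ∞) ≤ quantumQueryComplexity promise accepted :=
    le_iInf₂ fun T hT => Nat.cast_le.2 (by have := h T hT; omega)
  calc (n : ℕ∞) ≤ ((8 * ((n + 7) / 8) : ℕ) : ℕ∞) := Nat.cast_le.2 (by omega)
    _ = (8 : ℕ) * (((n + 7) / 8 : ℕ) : ℕ∞) := by push_cast; rfl
    _ ≤ _ := by gcongr

theorem stronglyConnected_iff_connected {n : ℕ} [NeZero n] {d : Fin n → ℕ} {f : Arrays n d}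
    (hf : f.Symmetric) : f.StronglyConnected ↔ (Arrays.graph f).Connected := by
  have : Nonempty (Fin n) := ⟨0⟩
  rw [SimpleGraph.connected_iff, and_iff_left this]
  refine forall₂_congr fun u v => ?_
  rw [SimpleGraph.reachable_iff_reflTransGen]
  constructor <;> intro h
  · induction h with
    | refl => exact .refl
    | @tail b c _ hbc ih =>
      by_cases he : b = c
      · exact he ▸ ih
      · exact ih.tail ((SimpleGraph.fromRel_adj _ _ _).2 ⟨he, Or.inl hbc⟩)
  · refine Relation.ReflTransGen.mono (fun a b hab => ?_) _ _ h
    exact ((SimpleGraph.fromRel_adj _ _ _).1 hab).2.elim id (hf _ _)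

theorem le_eight_mul_connectivityComplexity {n : ℕ} [NeZero n] (hn : 6 ≤ n) :
    (n : ℕ∞) ≤ (8 : ℕ) * connectivityComplexity n := by
  refine (le_eight_mul_quantumQueryComplexity fun T ⟨alg, h⟩ =>
    le_eight_mul_of_solves_connectivity hn h).trans ?_
  gcongr
  exact le_iSup_of_le (fun _ => 2) le_rfl

theorem le_eight_mul_spanningTreeComplexity {n : ℕ} [NeZero n] (hn : 6 ≤ n) :
    (n : ℕ∞) ≤ (8 : ℕ) * spanningTreeComplexity n := by
  have h1 : (n : ℕ∞) ≤ (8 : ℕ) * quantumQueryComplexity (Arrays.undirectedInputs n fun _ => 2)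
      (fun f => {o | SpanningTreeAnswer (Arrays.graph f) o}) := by
    refine le_eight_mul_quantumQueryComplexity fun T h => ?_
    obtain ⟨alg, h⟩ := solves_connectivity_of_spanningTree h
    exact le_eight_mul_of_solves_connectivity hn h
  refine h1.trans ?_
  gcongr
  exact le_iSup_of_le (fun _ => 2) le_rfl

theorem le_eight_mul_strongConnectivityComplexity {n : ℕ} [NeZero n] (hn : 6 ≤ n) :
    (n : ℕ∞) ≤ (8 : ℕ) * strongConnectivityComplexity n := by
  have h1 : (n : ℕ∞) ≤ (8 : ℕ) * quantumQueryComplexity (Arrays.directedInputs n fun _ => 2)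
      (fun f => {b : Bool | b = true ↔ Arrays.StronglyConnected f}) := by
    refine le_eight_mul_quantumQueryComplexity fun T ⟨alg, h⟩ => ?_
    -- The undirected inputs are among the directed ones, so the same algorithm decides connectivity
    -- on them.
    refine le_eight_mul_of_solves_connectivity hn (alg := alg) fun f hf => ?_
    have := h f hf.1
    simpa only [stronglyConnected_iff_connected hf.2] using this
  refine h1.trans ?_
  gcongr
  exact le_iSup_of_le (fun _ => 2) le_rfl

theorem mainTheorem12 :
    -- Strong Connectivity requires `Ω(n)` queries
    (∃ K N : ℕ, ∀ (n : ℕ) [NeZero n], N ≤ n → (n : ℕ∞) ≤ K * strongConnectivityComplexity n) ∧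
    -- Connectivity (decision) requires `Ω(n)` queries and can be solved with `O(n)` queries
    (∃ K N : ℕ, ∀ (n : ℕ) [NeZero n], N ≤ n → (n : ℕ∞) ≤ K * connectivityComplexity n) ∧
    (∃ K : ℕ, ∀ (n : ℕ) [NeZero n], connectivityComplexity n ≤ K * n) ∧
    -- the same for Connectivity with a spanning tree as output
    (∃ K N : ℕ, ∀ (n : ℕ) [NeZero n], N ≤ n → (n : ℕ∞) ≤ K * spanningTreeComplexity n) ∧
    (∃ K : ℕ, ∀ (n : ℕ) [NeZero n], spanningTreeComplexity n ≤ K * n) :=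
  ⟨⟨8, 6, fun _ _ hn => le_eight_mul_strongConnectivityComplexity hn⟩,
    ⟨8, 6, fun _ _ hn => le_eight_mul_connectivityComplexity hn⟩,
    ⟨144, fun n _ => connectivityComplexity_le n⟩,
    ⟨8, 6, fun _ _ hn => le_eight_mul_spanningTreeComplexity hn⟩,
    ⟨144, fun n _ => spanningTreeComplexity_le n⟩⟩
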